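/- Let $d\ge 4$. For a surface $X=\{F=0\}\subset\mathbb{CP}^3$ of degree $d$ (with $F\neq 0$ a form of degree $d$) and a line $L\not\subset X$, let $\alpha(L\cap X)$ be the partition of $d$ formed by the multiplicities, in decreasing order, of the zero-dimensional scheme $L\cap X$ at its points. Let $G(2,4)$ be the Grassmannian of lines of $\mathbb{CP}^3$, with its Zariski topology. There is a non-empty Zariski open subset $U$ of the projective space of all surfaces of degree $d$ such that every $X\in U$ contains no line and, for every $L\in G(2,4)$, the partition $\alpha(L\cap X)$ is one of the following (those among them that are partitions of $d$): - $(1,\dots,1)$, and the set of lines where it occurs is a non-empty Zariski open subset of $G(2,4)$; - $(2,1,\dots,1)$, and the set of lines where it occurs is a locally closed hypersurface of $G(2,4)$ (all its irreducible components have dimension $3$); - $(2,2,1,\dots,1)$ or $(3,1,\dots,1)$, and the set of lines where each of these occurs is a locally closed subvariety of $G(2,4)$ of dimension $2$; - $(2,2,2,1,\dots,1)$, $(3,2,1,\dots,1)$ or $(4,1,\dots,1)$, and the set of lines where each of these occurs is a locally closed subvariety of $G(2,4)$ of dimension $1$; - $(2,2,2,2,1,\dots,1)$, $(3,2,2,1,\dots,1)$,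 $(3,3,1,\dots,1)$, $(4,2,1,\dots,1)$ or $(5,1,\dots,1)$, and the set of lines where each of these occurs is finite. Apart from the first one, these sets are allowed to be empty. -/

import Mathlib

open scoped LinearAlgebra.Projectivization

noncomputable section

/-- The projective space of all surfaces of degree `d` in `ℂℙ³`: nonzero quaternary forms of
degree `d` up to a scalar. -/
def Surface (d : ℕ) : Type :=
  ℙ ℂ (MvPolynomial.homogeneousSubmodule (Fin 4) ℂ d)

/-- The Grassmannian `G(2,4)`: the lines of `ℂℙ³`, as planes of `ℂ⁴`. -/
def ProjLine : Type :=
  {L : Submodule ℂ (Fin 4 → ℂ) // Module.finrank ℂ L = 2}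

/-- A form defining the surface (unique up to a nonzero scalar). -/
def Surface.form {d : ℕ} (X : Surface d) : MvPolynomial (Fin 4) ℂ :=
  (Projectivization.rep X : MvPolynomial.homogeneousSubmodule (Fin 4) ℂ d).1

/-- The Zariski topology on the projective space of surfaces of degree `d`. Its basic open sets are
the nonvanishing loci of homogeneous polynomials in the coefficients of the form. -/
instance Surface.zariski (d : ℕ) : TopologicalSpace (Surface d) :=
  TopologicalSpace.generateFrom
    {U | ∃ (k : ℕ) (P : MvPolynomial (Fin 4 →₀ ℕ) ℂ), P.IsHomogeneous k ∧
      U = {X | MvPolynomial.eval (fun m => X.form.coeff m) P ≠ 0}}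

/-- The Plücker coordinates of the pair `(u, v)`. -/
def pluecker (u v : Fin 4 → ℂ) (ij : Fin 4 × Fin 4) : ℂ :=
  u ij.1 * v ij.2 - u ij.2 * v ij.1

/-- The Zariski topology on `G(2,4)`. Its basic open sets are the nonvanishing loci of homogeneous
polynomials in the Plücker coordinates (which are defined by the line up to a nonzero scalar). -/
instance ProjLine.zariski : TopologicalSpace ProjLine :=
  TopologicalSpace.generateFrom
    {U | ∃ (k : ℕ) (P : MvPolynomial (Fin 4 × Fin 4) ℂ), P.IsHomogeneous k ∧
      U = {L | ∃ u v : Fin 4 → ℂ, Submodule.span ℂ {u, v} = L.1 ∧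
        MvPolynomial.eval (pluecker u v) P ≠ 0}}

/-- The line `L` is contained in the surface `X`. -/
def Surface.ContainsLine {d : ℕ} (X : Surface d) (L : ProjLine) : Prop :=
  ∀ v ∈ L.1, MvPolynomial.eval v X.form = 0

/-- The set of points of `ℂℙ³` that lie on both `L` and `X`. -/
def Surface.inter {d : ℕ} (X : Surface d) (L : ProjLine) : Set (ℙ ℂ (Fin 4 → ℂ)) :=
  {q | q.submodule ≤ L.1 ∧ MvPolynomial.eval q.rep X.form = 0}

/-- The polynomial `F (a + t b)` in the variable `t`. -/
def alongLine (F : MvPolynomial (Fin 4) ℂ) (a b : Fin 4 → ℂ) : Polynomial ℂ :=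
  MvPolynomial.aeval (fun i => Polynomial.C (a i) + Polynomial.C (b i) * Polynomial.X) F

/-- The multiplicity of the scheme `L ∩ X` at the point `q = [a]` of `L`: the order at `t = 0` of
`F (a + t b)`, where `F` is a form defining `X` and `a`, `b` span `L`. All such `b` give the same
order, so the infimum is over a one-point set. -/
def Surface.interMult {d : ℕ} (X : Surface d) (L : ProjLine) (q : ℙ ℂ (Fin 4 → ℂ)) : ℕ :=
  sInf {m | ∃ b ∈ L.1, b ∉ q.submodule ∧ m = (alongLine X.form q.rep b).rootMultiplicity 0}

/-- The partition `α(L ∩ X)`: the multiset of the multiplicities of `L ∩ X` at its points (for `L`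
not contained in `X`, so that there are finitely many points). -/
def Surface.interPartition {d : ℕ} (X : Surface d) (L : ProjLine) : Multiset ℕ :=
  ∑ᶠ q ∈ X.inter L, ({X.interMult L q} : Multiset ℕ)

/-- The partition `(s, 1, …, 1)` of `d`. If the parts in `s` add up to more than `d`, this is not a
partition of `d`, and no line has it. -/
def withOnes (d : ℕ) (s : Multiset ℕ) : Multiset ℕ :=
  s + Multiset.replicate (d - s.sum) 1

/-- The set of lines `L` with `α(L ∩ X) = (s, 1, …, 1)`. -/
def Surface.stratum {d : ℕ} (X : Surface d) (s : Multiset ℕ) : Set ProjLine :=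
  {L | X.interPartition L = withOnes d s}

/-- A locally closed hypersurface of `G(2,4)` (possibly empty): a locally closed set all of whose
irreducible components have dimension `3 = dim G(2,4) - 1`. -/
def IsLocallyClosedHypersurface (T : Set ProjLine) : Prop :=
  IsLocallyClosed T ∧ ∀ Z ∈ irreducibleComponents T, topologicalKrullDim Z = 3

/-- A locally closed subvariety of `G(2,4)` that is empty or of dimension `n`. -/
def IsLocallyClosedOfDim (T : Set ProjLine) (n : ℕ) : Prop :=
  IsLocallyClosed T ∧ (T.Nonempty → topologicalKrullDim T = n)

end

/-!
Upper bounds: a form of degree `d` is determined by the coordinates of a line in a chart of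
`G(2,4)`, its coefficients at the monomials that vanish on the coordinate line of the chart, and its
restriction to the line; a restriction with `k` distinct roots is given by its leading coefficient
and these roots. Comparing the numbers of parameters, by transcendence degree, gives for a generic
surface `X` a nonzero relation between any `p` chart coordinates of the lines that meet `X` in at
most `d + p - 5` points. Hence these lines form a set of dimension less than `p`: there are none if
`p = 0` and finitely many if `p = 1`.

Lower bounds: in a chart, the lines whose multiplicities are given by `μ`, with `k` parts, or by a
coarsening of `μ`, are the projection of the scheme in `𝔸⁴ × 𝔸ᵏ` on which the monic restriction of
the form to the line equals `∏ i, (T - r i) ^ μ i`. It is cut out by `d` equations, so that by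
Krull's height theorem its dimension is at least `4 + k - d` at each of its points, and it is
integral over `𝔸⁴`, so that its projection is closed and has no smaller dimension.
-/

open MvPolynomial Topology TopologicalSpace

/-! ### Zariski topology on affine space -/

/-- Affine space `K^κ` with its Zariski topology. It is a structure, not a synonym of `κ → K`, so
that the product topology does not interfere. -/
@[ext]
structure ZariskiAffine (K κ : Type*) where
  /-- The coordinates of a point. -/
  coord : κ → K

namespace ZariskiAffine

variable {K κ : Type*} [Field K]

/-- The maximal ideal of a point, as a point of the prime spectrum. -/
noncomputable def toSpec (x : ZariskiAffine K κ) : PrimeSpectrum (MvPolynomial κ K) :=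
  pointToPoint (k := K) x.coord

noncomputable instance : TopologicalSpace (ZariskiAffine K κ) := .induced toSpec inferInstance

theorem isInducing_toSpec : IsInducing (toSpec : ZariskiAffine K κ → _) := ⟨rfl⟩

theorem mem_asIdeal_toSpec {x : ZariskiAffine K κ} {p : MvPolynomial κ K} :
    p ∈ (toSpec x).asIdeal ↔ eval x.coord p = 0 := by
  simp only [toSpec, pointToPoint, mem_vanishingIdeal_singleton_iff, aeval_eq_eval]

instance [Finite κ] : NoetherianSpace (ZariskiAffine K κ) := isInducing_toSpec.noetherianSpace

/-- The zero locus of an ideal in affine space. -/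
def zeros (I : Ideal (MvPolynomial κ K)) : Set (ZariskiAffine K κ) :=
  {x | ∀ p ∈ I, eval x.coord p = 0}

theorem zeros_eq_preimage (I : Ideal (MvPolynomial κ K)) :
    zeros I = toSpec ⁻¹' PrimeSpectrum.zeroLocus I :=
  Set.ext fun _ => forall₂_congr fun _ _ => mem_asIdeal_toSpec.symm

theorem isClosed_zeros (I : Ideal (MvPolynomial κ K)) : IsClosed (zeros I) :=
  zeros_eq_preimage I ▸
    (PrimeSpectrum.isClosed_zeroLocus _).preimage isInducing_toSpec.continuous

theorem zeros_anti : Antitone (zeros : Ideal (MvPolynomial κ K) → _) :=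
  fun _ _ hIJ _ hx p hp => hx p (hIJ hp)

/-- The nonvanishing locus of a polynomial in affine space. -/
def nonvanishing (p : MvPolynomial κ K) : Set (ZariskiAffine K κ) := {x | eval x.coord p ≠ 0}

theorem nonvanishing_eq_preimage (p : MvPolynomial κ K) :
    nonvanishing p = toSpec ⁻¹' PrimeSpectrum.basicOpen p :=
  Set.ext fun _ => not_congr mem_asIdeal_toSpec.symm

theorem isOpen_nonvanishing (p : MvPolynomial κ K) : IsOpen (nonvanishing p) :=
  nonvanishing_eq_preimage p ▸
    (PrimeSpectrum.basicOpen p).isOpen.preimage isInducing_toSpec.continuous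

theorem exists_mem_nonvanishing_subset {O : Set (ZariskiAffine K κ)} (hO : IsOpen O)
    {x : ZariskiAffine K κ} (hx : x ∈ O) :
    ∃ p : MvPolynomial κ K, x ∈ nonvanishing p ∧ nonvanishing p ⊆ O := by
  obtain ⟨V, hV, rfl⟩ := isInducing_toSpec.isOpen_iff.1 hO
  obtain ⟨_, ⟨p, rfl⟩, hxp, hpV⟩ :=
    PrimeSpectrum.isTopologicalBasis_basic_opens.exists_subset_of_mem_open hx hV
  exact ⟨p, mt mem_asIdeal_toSpec.2 hxp, fun _ hy => hpV (mt mem_asIdeal_toSpec.1 hy)⟩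

section Nullstellensatz

variable [IsAlgClosed K] [Finite κ]

theorem mem_of_forall_mem_zeros {P : Ideal (MvPolynomial κ K)} [P.IsPrime]
    {g : MvPolynomial κ K} (hg : ∀ x ∈ zeros P, eval x.coord g = 0) : g ∈ P := by
  rw [← IsPrime.vanishingIdeal_zeroLocus (K := K) P]
  intro x hx
  simpa [aeval_eq_eval] using hg ⟨x⟩ fun p hp => by simpa [aeval_eq_eval] using hx p hp

theorem zeros_subset_zeros_iff {P Q : Ideal (MvPolynomial κ K)} [P.IsPrime] :
    zeros P ⊆ zeros Q ↔ Q ≤ P :=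
  ⟨fun h _ hq => mem_of_forall_mem_zeros fun _ hx => h hx _ hq, fun h => zeros_anti h⟩

theorem isIrreducible_zeros (P : Ideal (MvPolynomial κ K)) [hP : P.IsPrime] :
    IsIrreducible (zeros P) := by
  refine ⟨?_, ?_⟩
  · by_contra hempty
    rw [Set.not_nonempty_iff_eq_empty] at hempty
    exact hP.one_notMem (mem_of_forall_mem_zeros fun x hx => by simp [hempty] at hx)
  · rintro U V hU hV ⟨x, hxP, hxU⟩ ⟨y, hyP, hyV⟩
    obtain ⟨g, hxg, hgU⟩ := exists_mem_nonvanishing_subset hU hxU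
    obtain ⟨h, hyh, hhV⟩ := exists_mem_nonvanishing_subset hV hyV
    by_contra hdisj
    have hgh : g * h ∈ P := mem_of_forall_mem_zeros fun z hz => by
      by_contra hne
      rw [map_mul] at hne
      exact hdisj ⟨z, hz, hgU (left_ne_zero_of_mul hne), hhV (right_ne_zero_of_mul hne)⟩
    exact (hP.mem_or_mem hgh).elim (fun hg => hxg (hxP g hg)) fun hh => hyh (hyP h hh)

end Nullstellensatz

end ZariskiAffine

/-! ### Krull dimension -/

section Topology

variable {X : Type*} [TopologicalSpace X]

theorem isIrreducible_preimage_val {Z Y O : Set X} (hZ : IsIrreducible Z) (hZY : Z ⊆ Y)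
    (hO : IsOpen O) (hZO : (Z ∩ O).Nonempty) : IsIrreducible ((↑) ⁻¹' Z : Set (Y ∩ O : Set X)) := by
  refine ⟨hZO.elim fun z hz => ⟨⟨z, hZY hz.1, hz.2⟩, hz.1⟩, ?_⟩
  rintro _ _ ⟨U, hU, rfl⟩ ⟨V, hV, rfl⟩ ⟨x, hxZ, hxU⟩ ⟨y, hyZ, hyV⟩
  obtain ⟨z, hz, ⟨hzO, hzU⟩, -, hzV⟩ := hZ.2 (O ∩ U) (O ∩ V) (hO.inter hU) (hO.inter hV)
    ⟨x, hxZ, x.2.2, hxU⟩ ⟨y, hyZ, y.2.2, hyV⟩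
  exact ⟨⟨z, hZY hz, hzO⟩, hz, hzU, hzV⟩

theorem krullDim_le_topologicalKrullDim_inter {α : Type*} [Preorder α] {Y O : Set X}
    (hO : IsOpen O) (f : α → IrreducibleCloseds X) (hf : StrictMono f)
    (hY : ∀ a, (f a : Set X) ⊆ Y) (hfO : ∀ a, ((f a : Set X) ∩ O).Nonempty) :
    Order.krullDim α ≤ topologicalKrullDim (Y ∩ O : Set X) := by
  let g (a : α) : IrreducibleCloseds (Y ∩ O : Set X) :=
    { carrier := (↑) ⁻¹' (f a : Set X)
      isIrreducible' := isIrreducible_preimage_val (f a).isIrreducible (hY a) hO (hfO a)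
      isClosed' := (f a).isClosed.preimage continuous_subtype_val }
  refine Order.krullDim_le_of_strictMono g fun a b hab => ?_
  refine lt_of_le_not_ge (fun z hz => (hf hab).le hz) fun hba => (hf hab).not_ge ?_
  have hbO : (f b : Set X) ∩ O ⊆ f a := fun z hz =>
    hba (show (⟨z, hY b hz.1, hz.2⟩ : (Y ∩ O : Set X)) ∈ g b from hz.1)
  calc (f b : Set X) ⊆ closure (f b ∩ O) :=
        subset_closure_inter_of_isPreirreducible_of_isOpen (f b).isIrreducible.2 hO (hfO b)
    _ ⊆ f a := closure_minimal hbO (f a).isClosed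

end Topology

section RingDimension

theorem ringKrullDim_le_of_forall_quotient_prime {R : Type*} [CommRing R] {n : WithBot ℕ∞}
    (h : ∀ P : Ideal R, P.IsPrime → ringKrullDim (R ⧸ P) ≤ n) : ringKrullDim R ≤ n := by
  rw [ringKrullDim, Order.krullDim_eq_iSup_coheight]
  refine iSup_le fun P => le_trans ?_ (h P.asIdeal P.2)
  rw [Order.coheight_eq_krullDim_Ici, ringKrullDim_quotient]
  exact Order.krullDim_le_of_strictMono (fun Q => ⟨Q.1, Q.2⟩) fun _ _ hQ => hQ

theorem ringKrullDim_le_of_isIntegral {A B : Type*} [CommRing A] [CommRing B] [Algebra A B]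
    [Algebra.IsIntegral A B] : ringKrullDim B ≤ ringKrullDim A :=
  Order.krullDim_le_of_strictMono (PrimeSpectrum.comap (algebraMap A B)) fun _ _ hPQ =>
    Ideal.IsIntegral.comap_lt_comap (R := A) hPQ

theorem ringKrullDim_le_trdeg (K B : Type*) [Field K] [CommRing B] [IsDomain B] [Algebra K B]
    [Algebra.FiniteType K B] : ringKrullDim B ≤ (Cardinal.toENat (Algebra.trdeg K B) : ℕ∞) := by
  obtain ⟨s, g, hg, hfin⟩ := exists_finite_inj_algHom_of_fg K B
  algebraize [g.toRingHom]
  have : Algebra.IsIntegral (MvPolynomial (Fin s) K) B := ⟨hfin.to_isIntegral⟩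
  have hind : AlgebraicIndependent K (g ∘ X) := (algebraicIndependent_X (Fin s) K).map' hg
  have hs : (s : Cardinal) ≤ Algebra.trdeg K B := by simpa using hind.lift_cardinalMk_le_trdeg
  calc ringKrullDim B ≤ ringKrullDim (MvPolynomial (Fin s) K) := ringKrullDim_le_of_isIntegral
    _ = (s : ℕ∞) := by simp
    _ ≤ _ := WithBot.coe_le_coe.2 (by simpa using Cardinal.toENat.monotone' hs)

theorem trdeg_le_of_forall_not_algebraicIndependent {K B κ : Type*} [Field K] [CommRing B]
    [IsDomain B] [Algebra K B] {x : κ → B} (hx : Algebra.adjoin K (Set.range x) = ⊤) {m : ℕ}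
    (h : ∀ ι : Fin (m + 1) ↪ κ, ¬ AlgebraicIndependent K (x ∘ ι)) : Algebra.trdeg K B ≤ m := by
  have halg : Algebra.IsAlgebraic (Algebra.adjoin K (Set.range x)) B := by
    rw [hx]
    exact ⟨fun b => isAlgebraic_algebraMap (⟨b, trivial⟩ : (⊤ : Subalgebra K B))⟩
  obtain ⟨t, htx, ht⟩ := exists_isTranscendenceBasis_subset (R := K) (Set.range x)
  rw [← ht.cardinalMk_eq_trdeg]
  by_contra! hlt
  obtain ⟨e⟩ : Nonempty (Fin (m + 1) ↪ t) := by
    rw [← Cardinal.lift_mk_le']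
    simpa [Order.succ_le_iff] using hlt
  choose f hf using fun b : t => htx b.2
  have hcomp : x ∘ f ∘ e = (↑) ∘ e := funext fun i => hf (e i)
  have hinj : Function.Injective (f ∘ e) := by
    refine .of_comp (f := x) ?_
    rw [hcomp]
    exact Subtype.val_injective.comp e.injective
  exact h ⟨f ∘ e, hinj⟩ (hcomp ▸ ht.1.comp e e.injective)

theorem ringKrullDim_le_of_forall_not_algebraicIndependent {K B κ : Type*} [Field K] [CommRing B]
    [Algebra K B] [Finite κ] {x : κ → B} (hx : Algebra.adjoin K (Set.range x) = ⊤) {m : ℕ}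
    (h : ∀ ι : Fin (m + 1) ↪ κ, ¬ AlgebraicIndependent K (x ∘ ι)) : ringKrullDim B ≤ m := by
  refine ringKrullDim_le_of_forall_quotient_prime fun P _ => ?_
  let π := Ideal.Quotient.mkₐ K P
  have hπ : Algebra.adjoin K (Set.range (π ∘ x)) = ⊤ := by
    rw [Set.range_comp, ← AlgHom.map_adjoin, hx, Algebra.map_top, AlgHom.range_eq_top]
    exact Ideal.Quotient.mkₐ_surjective K P
  have : Algebra.FiniteType K (B ⧸ P) := ⟨⟨(Set.finite_range (π ∘ x)).toFinset, by simpa using hπ⟩⟩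
  have htrdeg : Algebra.trdeg K (B ⧸ P) ≤ m :=
    trdeg_le_of_forall_not_algebraicIndependent hπ fun ι hι => h ι (.of_comp π hι)
  exact (ringKrullDim_le_trdeg K (B ⧸ P)).trans
    (WithBot.coe_le_coe.2 (by simpa using Cardinal.toENat.monotone' htrdeg))

end RingDimension

namespace ZariskiAffine

variable {K κ : Type*} [Field K]

theorem topologicalKrullDim_le_ringKrullDim_quotient {T : Set (ZariskiAffine K κ)}
    {J : Ideal (MvPolynomial κ K)} (hJ : T ⊆ zeros J) :
    topologicalKrullDim T ≤ ringKrullDim (MvPolynomial κ K ⧸ J) := by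
  have hrange (x : T) : toSpec x.1 ∈ Set.range (PrimeSpectrum.comap (Ideal.Quotient.mk J)) := by
    rw [range_comap_of_surjective _ _ Ideal.Quotient.mk_surjective, Ideal.mk_ker]
    exact fun p hp => mem_asIdeal_toSpec.2 (hJ x.2 p hp)
  choose f hf using hrange
  have hcomp : PrimeSpectrum.comap (Ideal.Quotient.mk J) ∘ f = toSpec ∘ Subtype.val := funext hf
  have hcomap := (PrimeSpectrum.isClosedEmbedding_comap_of_surjective _ (Ideal.Quotient.mk J)
    Ideal.Quotient.mk_surjective).isInducing
  have hind : IsInducing f := by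
    rw [← hcomap.of_comp_iff, hcomp]
    exact isInducing_toSpec.comp IsInducing.subtypeVal
  exact hind.topologicalKrullDim_le.trans_eq (PrimeSpectrum.topologicalKrullDim_eq_ringKrullDim _)

theorem topologicalKrullDim_le_of_relations [Finite κ] {T : Set (ZariskiAffine K κ)} {m : ℕ}
    (h : ∀ ι : Fin (m + 1) ↪ κ, ∃ q : MvPolynomial (Fin (m + 1)) K,
      q ≠ 0 ∧ ∀ x ∈ T, eval (x.coord ∘ ι) q = 0) :
    topologicalKrullDim T ≤ m := by
  let J : Ideal (MvPolynomial κ K) := ⨅ x : T, (toSpec x.1).asIdeal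
  have hJ : T ⊆ zeros J := fun x hx p hp => by
    have hp' : ∀ x : T, p ∈ (toSpec x.1).asIdeal := by simpa [J, Submodule.mem_iInf] using hp
    exact mem_asIdeal_toSpec.1 (hp' ⟨x, hx⟩)
  refine (topologicalKrullDim_le_ringKrullDim_quotient hJ).trans
    (ringKrullDim_le_of_forall_not_algebraicIndependent (K := K)
      (x := fun i => Ideal.Quotient.mkₐ K J (X i)) ?_ fun ι hι => ?_)
  · rw [Set.range_comp' (Ideal.Quotient.mkₐ K J), ← AlgHom.map_adjoin, adjoin_range_X,
      Algebra.map_top, AlgHom.range_eq_top]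
    exact Ideal.Quotient.mkₐ_surjective K J
  · obtain ⟨q, hq0, hq⟩ := h ι
    have hqJ : rename ι q ∈ J := (Submodule.mem_iInf _).2 fun x =>
      mem_asIdeal_toSpec.2 (by simpa [eval_rename] using hq x.1 x.2)
    refine hq0 (hι ?_)
    rw [map_zero, ← Ideal.Quotient.eq_zero_iff_mem.2 hqJ, ← Ideal.Quotient.mkₐ_eq_mk K,
      ← AlgHom.comp_apply]
    congr 1
    ext i
    simp

end ZariskiAffine

/-! ### Projections of integral covers of affine space -/

section Translation

variable {K κ : Type*} [Field K]

theorem exists_ringEquiv_comap_vanishingIdeal_singleton (y z : κ → K) :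
    ∃ e : MvPolynomial κ K ≃+* MvPolynomial κ K,
      (vanishingIdeal K {z} : Ideal (MvPolynomial κ K)).comap e = vanishingIdeal K {y} := by
  let e : MvPolynomial κ K ≃ₐ[K] MvPolynomial κ K :=
    AlgEquiv.ofAlgHom (aeval fun i => X i + C (y i - z i)) (aeval fun i => X i - C (y i - z i))
      (by ext i; simp [algHom_C]) (by ext i; simp [algHom_C])
  refine ⟨e, Ideal.ext fun p => ?_⟩
  have he : (aeval z).comp e.toAlgHom = (aeval y : MvPolynomial κ K →ₐ[K] K) := by
    ext i
    simp [e]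
  rw [Ideal.mem_comap, mem_vanishingIdeal_singleton_iff, mem_vanishingIdeal_singleton_iff, ← he]
  rfl

theorem height_vanishingIdeal_singleton [IsAlgClosed K] [Fintype κ] (y : κ → K) :
    (vanishingIdeal K {y} : Ideal (MvPolynomial κ K)).height = Fintype.card κ := by
  have hdim : ringKrullDim (MvPolynomial κ K) = (Fintype.card κ : ℕ) := by simp
  have : FiniteRingKrullDim (MvPolynomial κ K) := by
    rw [finiteRingKrullDim_iff_ne_bot_and_top, hdim]
    exact ⟨by simp, fun h => ENat.natCast_ne_top (Fintype.card κ) (WithBot.coe_injective h)⟩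
  obtain ⟨P, hP, hPh⟩ := Ideal.exists_isMaximal_height (R := MvPolynomial κ K)
  obtain ⟨z, rfl⟩ := eq_vanishingIdeal_singleton_of_isMaximal K hP
  obtain ⟨e, he⟩ := exists_ringEquiv_comap_vanishingIdeal_singleton y z
  rw [← he, RingEquiv.height_comap]
  exact_mod_cast hPh.trans hdim

end Translation

namespace ZariskiAffine

variable {K κ ρ : Type*} [Field K] (E : Finset (MvPolynomial (κ ⊕ ρ) K))

/-- The projection to `K^κ` of the zero locus of the equations `E` in `K^κ × K^ρ`. -/
def projZeros : Set (ZariskiAffine K κ) :=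
  {x | ∃ r : ρ → K, ∀ e ∈ E, eval (Sum.elim x.coord r) e = 0}

/-- The coordinate ring of the scheme cut out by the equations `E` in `K^κ × K^ρ`. -/
abbrev CoverRing : Type _ :=
  MvPolynomial (κ ⊕ ρ) K ⧸ Ideal.span (E : Set (MvPolynomial (κ ⊕ ρ) K))

/-- The quotient map onto the coordinate ring of the scheme cut out by `E`. -/
noncomputable abbrev coverMk : MvPolynomial (κ ⊕ ρ) K →+* CoverRing E := Ideal.Quotient.mk _

/-- The map of coordinate rings induced by the projection to `K^κ` of the scheme cut out by `E`. -/
noncomputable def coverMap : MvPolynomial κ K →+* CoverRing E :=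
  (coverMk E).comp (rename Sum.inl).toRingHom

theorem coverMap_apply (p : MvPolynomial κ K) : coverMap E p = coverMk E (rename Sum.inl p) := rfl

theorem coverMk_eq_zero {e : MvPolynomial (κ ⊕ ρ) K} (he : e ∈ E) : coverMk E e = 0 :=
  Ideal.Quotient.eq_zero_iff_mem.2 (Ideal.subset_span he)

theorem coverMap_isIntegral_of_isIntegralElem
    (h : ∀ i : ρ, (coverMap E).IsIntegralElem (coverMk E (X (Sum.inr i)))) :
    (coverMap E).IsIntegral := by
  intro s
  obtain ⟨p, rfl⟩ := Ideal.Quotient.mk_surjective s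
  induction p using MvPolynomial.induction_on with
  | C a =>
    rw [show C a = rename Sum.inl (C a : MvPolynomial κ K) by simp]
    exact (coverMap E).isIntegralElem_map
  | add p q hp hq =>
    rw [map_add]
    exact hp.add _ hq
  | mul_X p i hp =>
    rw [map_mul]
    refine hp.mul _ ?_
    rcases i with i | i
    · rw [show X (Sum.inl i) = rename Sum.inl (X i : MvPolynomial κ K) by simp]
      exact (coverMap E).isIntegralElem_map
    · exact h i

theorem projZeros_subset_zeros_ker : projZeros E ⊆ zeros (RingHom.ker (coverMap E)) := by
  rintro x ⟨r, hr⟩ p hp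
  rw [RingHom.mem_ker, coverMap_apply, Ideal.Quotient.eq_zero_iff_mem] at hp
  have hle : Ideal.span (E : Set (MvPolynomial (κ ⊕ ρ) K)) ≤
      RingHom.ker (eval (Sum.elim x.coord r)) := Ideal.span_le.2 hr
  simpa [RingHom.mem_ker, eval_rename] using hle hp

variable [IsAlgClosed K] {E}

section Finite

variable [Finite κ] [Finite ρ]

theorem mem_projZeros_of_isMaximal {x : ZariskiAffine K κ} {Q : Ideal (CoverRing E)}
    (hQ : Q.IsMaximal) (hQx : Q.comap (coverMap E) = (toSpec x).asIdeal) : x ∈ projZeros E := by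
  have hQ' : (Q.comap (coverMk E)).IsMaximal :=
    Ideal.comap_isMaximal_of_surjective _ Ideal.Quotient.mk_surjective
  obtain ⟨y, hy⟩ := eq_vanishingIdeal_singleton_of_isMaximal K hQ'
  have hmem (p : MvPolynomial (κ ⊕ ρ) K) : coverMk E p ∈ Q ↔ eval y p = 0 := by
    rw [← Ideal.mem_comap, hy, mem_vanishingIdeal_singleton_iff, aeval_eq_eval]
  have hyx (i : κ) : y (Sum.inl i) = x.coord i := by
    have hi : (X i - C (x.coord i) : MvPolynomial κ K) ∈ (toSpec x).asIdeal := by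
      simp [mem_asIdeal_toSpec]
    rw [← hQx, Ideal.mem_comap, coverMap_apply, hmem] at hi
    simpa [sub_eq_zero] using hi
  have hyelim : Sum.elim x.coord (y ∘ Sum.inr) = y := by
    ext (i | i) <;> simp [hyx]
  refine ⟨y ∘ Sum.inr, fun e he => ?_⟩
  rw [hyelim, ← hmem, coverMk_eq_zero E he]
  exact Q.zero_mem

theorem projZeros_eq_zeros_ker (h : (coverMap E).IsIntegral) :
    projZeros E = zeros (RingHom.ker (coverMap E)) := by
  refine (projZeros_subset_zeros_ker E).antisymm fun x hx => ?_
  have hker : RingHom.ker (coverMap E) ≤ (toSpec x).asIdeal := fun p hp =>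
    mem_asIdeal_toSpec.2 (hx p hp)
  have hmax : (toSpec x).asIdeal.IsMaximal :=
    inferInstanceAs (vanishingIdeal K {x.coord} : Ideal (MvPolynomial κ K)).IsMaximal
  algebraize [coverMap E]
  obtain ⟨Q, hQ, hQx⟩ := Ideal.exists_ideal_over_maximal_of_isIntegral (S := CoverRing E)
    (toSpec x).asIdeal hker
  exact mem_projZeros_of_isMaximal hQ hQx

theorem isClosed_projZeros (h : (coverMap E).IsIntegral) : IsClosed (projZeros E) := by
  rw [projZeros_eq_zeros_ker h]
  exact isClosed_zeros _

end Finite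

variable [Fintype κ] [Fintype ρ]

theorem exists_le_height_comap_coverMk {y : κ ⊕ ρ → K}
    (hy : ∀ e ∈ E, eval y e = 0) {n : ℕ} (hn : n + E.card ≤ Fintype.card κ + Fintype.card ρ) :
    ∃ M : PrimeSpectrum (CoverRing E),
      M.asIdeal.comap (coverMk E) = vanishingIdeal K {y} ∧ (n : ℕ∞) ≤ Order.height M := by
  let I : Ideal (MvPolynomial (κ ⊕ ρ) K) := vanishingIdeal K {y}
  have hEI : (E : Set (MvPolynomial (κ ⊕ ρ) K)) ⊆ I := fun e he => by
    rw [SetLike.mem_coe, mem_vanishingIdeal_singleton_iff, aeval_eq_eval]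
    exact hy e he
  have hprime : (I.map (coverMk E)).IsPrime :=
    Ideal.isPrime_map_quotientMk_of_isPrime (Ideal.span_le.2 hEI)
  refine ⟨⟨I.map (coverMk E), hprime⟩, ?_, ?_⟩
  · change (I.map (coverMk E)).comap (coverMk E) = I
    rw [Ideal.comap_map_of_surjective _ Ideal.Quotient.mk_surjective, ← RingHom.ker_eq_comap_bot,
      Ideal.mk_ker, sup_eq_left.2 (Ideal.span_le.2 hEI)]
  · have hheight : I.height ≤ (I.map (coverMk E)).height + E.card := by
      simpa using Ideal.height_le_height_add_encard_of_subset (p := I) _ hEI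
    rw [height_vanishingIdeal_singleton, Fintype.card_sum] at hheight
    have hadd : (n : ℕ∞) + E.card ≤ (I.map (coverMk E)).height + E.card :=
      le_trans (by exact_mod_cast hn) hheight
    rw [← PrimeSpectrum.height_eq_orderHeight]
    exact (ENat.add_le_add_iff_right (ENat.natCast_ne_top _)).1 hadd

theorem le_topologicalKrullDim_projZeros_inter (h : (coverMap E).IsIntegral)
    {O : Set (ZariskiAffine K κ)} (hO : IsOpen O) {x : ZariskiAffine K κ}
    (hx : x ∈ projZeros E) (hxO : x ∈ O) {n : ℕ}
    (hn : n + E.card ≤ Fintype.card κ + Fintype.card ρ) :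
    n ≤ topologicalKrullDim (projZeros E ∩ O : Set (ZariskiAffine K κ)) := by
  obtain ⟨r, hr⟩ := hx
  obtain ⟨M, hM, hheight⟩ := exists_le_height_comap_coverMk hr hn
  algebraize [coverMap E]
  let f (Q : (Set.Iic M)ᵒᵈ) : IrreducibleCloseds (ZariskiAffine K κ) :=
    ⟨zeros ((OrderDual.ofDual Q).1.asIdeal.comap (coverMap E)), isIrreducible_zeros _,
      isClosed_zeros _⟩
  have hf : StrictMono f := by
    intro P Q hPQ
    have hlt : (OrderDual.ofDual Q).1.asIdeal.comap (coverMap E) <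
        (OrderDual.ofDual P).1.asIdeal.comap (coverMap E) :=
      Ideal.IsIntegral.comap_lt_comap (R := MvPolynomial κ K)
        (show (OrderDual.ofDual Q).1.asIdeal < (OrderDual.ofDual P).1.asIdeal from hPQ)
    exact lt_of_le_not_ge (zeros_anti hlt.le) fun hge => hlt.not_ge (zeros_subset_zeros_iff.1 hge)
  have hfsub (Q : (Set.Iic M)ᵒᵈ) : (f Q : Set (ZariskiAffine K κ)) ⊆ projZeros E := by
    rw [projZeros_eq_zeros_ker h]
    exact zeros_anti fun p hp => by
      rw [Ideal.mem_comap, RingHom.mem_ker.1 hp]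
      exact Ideal.zero_mem _
  have hxf (Q : (Set.Iic M)ᵒᵈ) : x ∈ (f Q : Set (ZariskiAffine K κ)) := fun p hp => by
    have hpM : rename Sum.inl p ∈ M.asIdeal.comap (coverMk E) := (OrderDual.ofDual Q).2 hp
    rw [hM, mem_vanishingIdeal_singleton_iff, aeval_eq_eval] at hpM
    simpa [eval_rename] using hpM
  calc (n : WithBot ℕ∞) ≤ Order.height M := by exact_mod_cast hheight
    _ = Order.krullDim (Set.Iic M)ᵒᵈ := by
      rw [Order.krullDim_orderDual, Order.height_eq_krullDim_Iic]
    _ ≤ _ := krullDim_le_topologicalKrullDim_inter hO f hf hfsub fun Q => ⟨x, hxf Q, hxO⟩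

end ZariskiAffine

/-! ### Charts of the Grassmannian -/

theorem pluecker_eq_smul {u v u' v' : Fin 4 → ℂ}
    (h : Submodule.span ℂ {u', v'} ≤ Submodule.span ℂ {u, v}) :
    ∃ c : ℂ, pluecker u' v' = c • pluecker u v := by
  obtain ⟨a, b, hu⟩ := Submodule.mem_span_pair.1 (h (Submodule.mem_span_of_mem (.inl rfl)))
  obtain ⟨c, e, hv⟩ := Submodule.mem_span_pair.1 (h (Submodule.mem_span_of_mem (.inr rfl)))
  refine ⟨a * e - b * c, funext fun ij => ?_⟩
  simp only [← hu, ← hv, pluecker, Pi.add_apply, Pi.smul_apply, smul_eq_mul]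
  ring

theorem linearIndependent_iff_exists_pluecker_ne_zero {u v : Fin 4 → ℂ} :
    LinearIndependent ℂ ![u, v] ↔ ∃ ij, pluecker u v ij ≠ 0 := by
  rw [LinearIndependent.pair_iff]
  constructor
  · contrapose!
    intro h
    have hminor (i j : Fin 4) : u i * v j - u j * v i = 0 := h (i, j)
    by_cases hu : u = 0
    · exact ⟨1, 0, by simp [hu], by simp⟩
    · obtain ⟨i, hi⟩ := Function.ne_iff.1 hu
      refine ⟨v i, -u i, funext fun j => ?_, fun _ => neg_ne_zero.2 hi⟩
      simp only [Pi.add_apply, Pi.smul_apply, smul_eq_mul, Pi.zero_apply]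
      linear_combination -hminor i j
  · rintro ⟨⟨i, j⟩, h⟩ s t hst
    replace h : u i * v j - u j * v i ≠ 0 := h
    have hi : s * u i + t * v i = 0 := congrFun hst i
    have hj : s * u j + t * v j = 0 := congrFun hst j
    have hs : s * (u i * v j - u j * v i) = 0 := by linear_combination v j * hi - v i * hj
    have ht : t * (u i * v j - u j * v i) = 0 := by linear_combination u i * hj - u j * hi
    exact ⟨(mul_eq_zero.1 hs).resolve_right h, (mul_eq_zero.1 ht).resolve_right h⟩

theorem finrank_span_pair {K V : Type*} [DivisionRing K] [AddCommGroup V] [Module K V] {u v : V}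
    (h : LinearIndependent K ![u, v]) : Module.finrank K (Submodule.span K {u, v}) = 2 := by
  rw [← Matrix.range_cons_cons_empty u v ![], finrank_span_eq_card h, Fintype.card_fin]

theorem eval_smul_of_isHomogeneous {R κ : Type*} [CommSemiring R] {P : MvPolynomial κ R} {k : ℕ}
    (hP : P.IsHomogeneous k) (c : R) (x : κ → R) : eval (c • x) P = c ^ k * eval x P := by
  rw [eval_eq, eval_eq, Finset.mul_sum]
  refine Finset.sum_congr rfl fun m hm => ?_
  have hdeg : ∑ i ∈ m.support, m i = k := by
    rw [← Finsupp.degree_apply, Finsupp.degree_eq_weight_one]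
    exact hP (mem_support_iff.1 hm)
  simp only [Pi.smul_apply, smul_eq_mul, mul_pow, Finset.prod_mul_distrib,
    Finset.prod_pow_eq_pow_sum, hdeg]
  ring

namespace ProjLine

/-- The nonvanishing locus of a form in the Plücker coordinates. -/
def basicOpen (P : MvPolynomial (Fin 4 × Fin 4) ℂ) : Set ProjLine :=
  {L | ∃ u v : Fin 4 → ℂ, Submodule.span ℂ {u, v} = L.1 ∧ eval (pluecker u v) P ≠ 0}

section BasicOpen

variable {P : MvPolynomial (Fin 4 × Fin 4) ℂ} {k : ℕ} (hP : P.IsHomogeneous k)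

include hP

theorem isOpen_basicOpen : IsOpen (basicOpen P) :=
  isOpen_generateFrom_of_mem ⟨k, P, hP, rfl⟩

theorem mem_basicOpen_iff {L : ProjLine} {u v : Fin 4 → ℂ} (h : Submodule.span ℂ {u, v} = L.1) :
    L ∈ basicOpen P ↔ eval (pluecker u v) P ≠ 0 := by
  refine ⟨?_, fun hne => ⟨u, v, h, hne⟩⟩
  rintro ⟨u', v', h', hne⟩ h0
  obtain ⟨c, hc⟩ := pluecker_eq_smul (h'.trans h.symm).le
  rw [hc, eval_smul_of_isHomogeneous hP, h0, mul_zero] at hne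
  exact hne rfl

end BasicOpen

section ChartVectors

variable {R S : Type*} [CommRing R] [CommRing S]

/-- The first spanning vector of the line with coordinates `x` in the chart attached to `σ`, where
the coordinates of `ℂ⁴` are listed in the order `σ 0, σ 1, σ 2, σ 3`. -/
def chartFst (σ : Equiv.Perm (Fin 4)) (x : Fin 4 → R) (i : Fin 4) : R :=
  ![1, 0, x 0, x 1] (σ.symm i)

/-- The second spanning vector of the line with coordinates `x` in the chart attached to `σ`. -/
def chartSnd (σ : Equiv.Perm (Fin 4)) (x : Fin 4 → R) (i : Fin 4) : R :=
  ![0, 1, x 2, x 3] (σ.symm i)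

@[simp] theorem chartFst_apply (σ : Equiv.Perm (Fin 4)) (x : Fin 4 → R) (j : Fin 4) :
    chartFst σ x (σ j) = ![1, 0, x 0, x 1] j := by simp [chartFst]

@[simp] theorem chartSnd_apply (σ : Equiv.Perm (Fin 4)) (x : Fin 4 → R) (j : Fin 4) :
    chartSnd σ x (σ j) = ![0, 1, x 2, x 3] j := by simp [chartSnd]

theorem map_chartFst (f : R →+* S) (σ : Equiv.Perm (Fin 4)) (x : Fin 4 → R) (i : Fin 4) :
    f (chartFst σ x i) = chartFst σ (f ∘ x) i := by
  obtain ⟨j, rfl⟩ := σ.surjective i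
  fin_cases j <;> simp

theorem map_chartSnd (f : R →+* S) (σ : Equiv.Perm (Fin 4)) (x : Fin 4 → R) (i : Fin 4) :
    f (chartSnd σ x i) = chartSnd σ (f ∘ x) i := by
  obtain ⟨j, rfl⟩ := σ.surjective i
  fin_cases j <;> simp

theorem chartFst_eq {σ : Equiv.Perm (Fin 4)} {u : Fin 4 → R} (h₀ : u (σ 0) = 1)
    (h₁ : u (σ 1) = 0) (a b : R) : chartFst σ ![u (σ 2), u (σ 3), a, b] = u := by
  ext i
  obtain ⟨j, rfl⟩ := σ.surjective i
  fin_cases j <;> simp [h₀, h₁]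

theorem chartSnd_eq {σ : Equiv.Perm (Fin 4)} {v : Fin 4 → R} (h₀ : v (σ 0) = 0)
    (h₁ : v (σ 1) = 1) (a b : R) : chartSnd σ ![a, b, v (σ 2), v (σ 3)] = v := by
  ext i
  obtain ⟨j, rfl⟩ := σ.surjective i
  fin_cases j <;> simp [h₀, h₁]

end ChartVectors

theorem pluecker_chart (σ : Equiv.Perm (Fin 4)) (x : Fin 4 → ℂ) :
    pluecker (chartFst σ x) (chartSnd σ x) (σ 0, σ 1) = 1 := by
  simp [pluecker]

theorem linearIndependent_chart (σ : Equiv.Perm (Fin 4)) (x : Fin 4 → ℂ) :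
    LinearIndependent ℂ ![chartFst σ x, chartSnd σ x] :=
  linearIndependent_iff_exists_pluecker_ne_zero.2 ⟨(σ 0, σ 1), by simp [pluecker_chart]⟩

/-- The affine chart of the Grassmannian formed by the lines whose Plücker coordinate
`(σ 0, σ 1)` does not vanish. -/
def chart (σ : Equiv.Perm (Fin 4)) (x : ZariskiAffine ℂ (Fin 4)) : ProjLine :=
  ⟨Submodule.span ℂ {chartFst σ x.coord, chartSnd σ x.coord},
    finrank_span_pair (linearIndependent_chart σ x.coord)⟩

theorem span_chart (σ : Equiv.Perm (Fin 4)) (x : ZariskiAffine ℂ (Fin 4)) :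
    Submodule.span ℂ {chartFst σ x.coord, chartSnd σ x.coord} = (chart σ x).1 := rfl

theorem exists_chart_eq_of_span_le {σ : Equiv.Perm (Fin 4)} {L : ProjLine} {u v : Fin 4 → ℂ}
    (huL : u ∈ L.1) (hvL : v ∈ L.1) (hu₀ : u (σ 0) = 1) (hu₁ : u (σ 1) = 0) (hv₀ : v (σ 0) = 0)
    (hv₁ : v (σ 1) = 1) : ∃ x, chart σ x = L := by
  refine ⟨⟨![u (σ 2), u (σ 3), v (σ 2), v (σ 3)]⟩, Subtype.ext ?_⟩
  refine Submodule.eq_of_le_of_finrank_eq ?_ ((chart σ _).2.trans L.2.symm)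
  rw [← span_chart, chartFst_eq hu₀ hu₁, chartSnd_eq hv₀ hv₁, Submodule.span_le]
  exact Set.pair_subset huL hvL

theorem exists_chart_eq (σ : Equiv.Perm (Fin 4)) {L : ProjLine} {u v : Fin 4 → ℂ}
    (hL : Submodule.span ℂ {u, v} = L.1) (h : pluecker u v (σ 0, σ 1) ≠ 0) :
    ∃ x, chart σ x = L := by
  obtain ⟨c, hc⟩ : ∃ c, c * (u (σ 0) * v (σ 1) - u (σ 1) * v (σ 0)) = 1 := ⟨_, inv_mul_cancel₀ h⟩
  have hu : u ∈ L.1 := hL ▸ Submodule.mem_span_of_mem (.inl rfl)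
  have hv : v ∈ L.1 := hL ▸ Submodule.mem_span_of_mem (.inr rfl)
  -- Cramer's rule: invert the minor of `(u, v)` in the columns `σ 0`, `σ 1`.
  refine exists_chart_eq_of_span_le (u := (c * v (σ 1)) • u - (c * u (σ 1)) • v)
    (v := (c * u (σ 0)) • v - (c * v (σ 0)) • u)
    (sub_mem (Submodule.smul_mem _ _ hu) (Submodule.smul_mem _ _ hv))
    (sub_mem (Submodule.smul_mem _ _ hv) (Submodule.smul_mem _ _ hu)) ?_ ?_ ?_ ?_ <;>
  simp only [Pi.sub_apply, Pi.smul_apply, smul_eq_mul] <;> grind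

theorem exists_span_pair (L : ProjLine) :
    ∃ u v : Fin 4 → ℂ, Submodule.span ℂ {u, v} = L.1 ∧ LinearIndependent ℂ ![u, v] := by
  let b := Module.finBasisOfFinrankEq ℂ L.1 L.2
  have hb : LinearIndependent ℂ ![(b 0 : Fin 4 → ℂ), b 1] := by
    have hb' : ![(b 0 : Fin 4 → ℂ), b 1] = L.1.subtype ∘ b := by
      ext i : 1
      fin_cases i <;> simp
    rw [hb']
    exact b.linearIndependent.map' L.1.subtype (Submodule.ker_subtype _)
  refine ⟨b 0, b 1, ?_, hb⟩
  refine Submodule.eq_of_le_of_finrank_eq ?_ ((finrank_span_pair hb).trans L.2.symm)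
  exact Submodule.span_le.2 (Set.pair_subset (b 0).2 (b 1).2)

theorem exists_perm_apply_zero_one :
    ∀ i j : Fin 4, i ≠ j → ∃ σ : Equiv.Perm (Fin 4), σ 0 = i ∧ σ 1 = j := by
  decide

theorem exists_chart (L : ProjLine) : ∃ σ x, chart σ x = L := by
  obtain ⟨u, v, hL, hind⟩ := exists_span_pair L
  obtain ⟨⟨i, j⟩, hij⟩ := linearIndependent_iff_exists_pluecker_ne_zero.1 hind
  have hne : i ≠ j := by
    rintro rfl
    simp [pluecker] at hij
  obtain ⟨σ, rfl, rfl⟩ := exists_perm_apply_zero_one i j hne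
  exact ⟨σ, exists_chart_eq σ hL hij⟩

/-- The Plücker coordinates that restrict to the coordinate functions of a chart. -/
def chartCoord (σ : Equiv.Perm (Fin 4)) : Fin 4 → Fin 4 × Fin 4 :=
  ![(σ 2, σ 1), (σ 3, σ 1), (σ 0, σ 2), (σ 0, σ 3)]

theorem pluecker_chartCoord (σ : Equiv.Perm (Fin 4)) (x : Fin 4 → ℂ) (i : Fin 4) :
    pluecker (chartFst σ x) (chartSnd σ x) (chartCoord σ i) = x i := by
  fin_cases i <;> simp [pluecker, chartCoord]

theorem chart_injective (σ : Equiv.Perm (Fin 4)) : Function.Injective (chart σ) := by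
  intro x y hxy
  obtain ⟨c, hc⟩ := pluecker_eq_smul (congrArg Subtype.val hxy).le
  have hc1 : 1 = c := by simpa [pluecker_chart] using congrFun hc (σ 0, σ 1)
  ext i
  simpa [pluecker_chartCoord, ← hc1] using congrFun hc (chartCoord σ i)

theorem continuous_chart (σ : Equiv.Perm (Fin 4)) : Continuous (chart σ) := by
  refine continuous_generateFrom_iff.2 ?_
  rintro _ ⟨k, P, hP, rfl⟩
  let x : Fin 4 → MvPolynomial (Fin 4) ℂ := X
  let Q : MvPolynomial (Fin 4) ℂ := aeval (fun ij : Fin 4 × Fin 4 =>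
    chartFst σ x ij.1 * chartSnd σ x ij.2 - chartFst σ x ij.2 * chartSnd σ x ij.1) P
  have hQ (y : ZariskiAffine ℂ (Fin 4)) :
      eval y.coord Q = eval (pluecker (chartFst σ y.coord) (chartSnd σ y.coord)) P := by
    have hx : eval y.coord ∘ x = y.coord := funext fun i => eval_X i
    simp only [Q, aeval_def]
    rw [hom_eval₂]
    congr 1
    · ext; simp
    · ext ij
      simp only [map_sub, map_mul, map_chartFst, map_chartSnd, pluecker, hx]
  convert ZariskiAffine.isOpen_nonvanishing Q using 1
  ext y
  exact (mem_basicOpen_iff hP (span_chart σ y)).trans (by rw [← hQ]; rfl)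

/-- The homogenization, in the Plücker coordinates, of a polynomial on a chart. The additional
factor `X (σ 0, σ 1)` makes it vanish outside the chart. -/
noncomputable def homogenization (σ : Equiv.Perm (Fin 4)) (h : MvPolynomial (Fin 4) ℂ) :
    MvPolynomial (Fin 4 × Fin 4) ℂ :=
  X (σ 0, σ 1) * ∑ m ∈ h.support, C (coeff m h) *
    (X (σ 0, σ 1) ^ (h.totalDegree - ∑ i, m i) * ∏ i, X (chartCoord σ i) ^ m i)

theorem isHomogeneous_homogenization (σ : Equiv.Perm (Fin 4)) (h : MvPolynomial (Fin 4) ℂ) :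
    (homogenization σ h).IsHomogeneous (1 + h.totalDegree) := by
  refine (isHomogeneous_X _ _).mul (IsHomogeneous.sum _ _ _ fun m hm => ?_)
  have hdeg : ∑ i, m i ≤ h.totalDegree := by
    simpa [Finsupp.sum_fintype] using le_totalDegree hm
  have hterm := (isHomogeneous_C (Fin 4 × Fin 4) (coeff m h)).mul
    (((isHomogeneous_X ℂ (σ 0, σ 1)).pow (h.totalDegree - ∑ i, m i)).mul
      (IsHomogeneous.prod Finset.univ _ _ fun i _ =>
        (isHomogeneous_X ℂ (chartCoord σ i)).pow (m i)))
  convert hterm using 1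
  simp only [one_mul, zero_add]
  omega

theorem eval_homogenization_chart (σ : Equiv.Perm (Fin 4)) (h : MvPolynomial (Fin 4) ℂ)
    (x : Fin 4 → ℂ) :
    eval (pluecker (chartFst σ x) (chartSnd σ x)) (homogenization σ h) = eval x h := by
  rw [eval_eq' x h]
  simp [homogenization, pluecker_chart, pluecker_chartCoord]

theorem image_chart_nonvanishing (σ : Equiv.Perm (Fin 4)) (h : MvPolynomial (Fin 4) ℂ) :
    chart σ '' ZariskiAffine.nonvanishing h = basicOpen (homogenization σ h) := by
  ext L
  constructor
  · rintro ⟨x, hx, rfl⟩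
    exact ⟨_, _, rfl, by rwa [eval_homogenization_chart]⟩
  · rintro ⟨u, v, huv, hne⟩
    have h0 : pluecker u v (σ 0, σ 1) ≠ 0 := fun h0 => hne (by simp [homogenization, h0])
    obtain ⟨x, rfl⟩ := exists_chart_eq σ huv h0
    have hx := (mem_basicOpen_iff (isHomogeneous_homogenization σ h) (span_chart σ x)).1
      ⟨u, v, huv, hne⟩
    rw [eval_homogenization_chart] at hx
    exact ⟨x, hx, rfl⟩

theorem isOpenEmbedding_chart (σ : Equiv.Perm (Fin 4)) : IsOpenEmbedding (chart σ) := by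
  refine .of_continuous_injective_isOpenMap (continuous_chart σ) (chart_injective σ) ?_
  intro O hO
  rw [isOpen_iff_forall_mem_open]
  rintro _ ⟨x, hx, rfl⟩
  obtain ⟨h, hxh, hh⟩ := ZariskiAffine.exists_mem_nonvanishing_subset hO hx
  refine ⟨chart σ '' ZariskiAffine.nonvanishing h, Set.image_mono hh, ?_, ⟨x, hxh, rfl⟩⟩
  rw [image_chart_nonvanishing]
  exact isOpen_basicOpen (isHomogeneous_homogenization σ h)

instance : NoetherianSpace ProjLine := by
  have hcover : (Set.univ : Set ProjLine) = ⋃ σ, Set.range (chart σ) := by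
    ext L
    simpa using exists_chart L
  rw [← noetherian_univ_iff, hcover]
  have hrange (σ : Equiv.Perm (Fin 4)) : NoetherianSpace (Set.range (chart σ)) :=
    NoetherianSpace.range (chart σ) (continuous_chart σ)
  exact NoetherianSpace.iUnion _

end ProjLine

theorem topologicalKrullDim_le_of_isOpenEmbedding_cover {ι Y : Type*} {X : ι → Type*}
    [TopologicalSpace Y] [∀ i, TopologicalSpace (X i)] {f : ∀ i, X i → Y}
    (hf : ∀ i, IsOpenEmbedding (f i)) (hsurj : ∀ y, ∃ i x, f i x = y) {n : WithBot ℕ∞}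
    (h : ∀ i, topologicalKrullDim (X i) ≤ n) : topologicalKrullDim Y ≤ n := by
  rw [topologicalKrullDim, Order.krullDim_eq_iSup_coheight]
  refine iSup_le fun Z => ?_
  obtain ⟨z, hz⟩ := Z.isIrreducible.nonempty
  obtain ⟨i, x, rfl⟩ := hsurj z
  let e := IrreducibleCloseds.orderIsoOfIsOpenEmbedding (f i) (hf i)
  have he : IrreducibleCloseds.map (f i) (hf i).continuous (e.symm ⟨Z, ⟨x, hz⟩⟩) = Z :=
    congrArg Subtype.val (e.apply_symm_apply ⟨Z, ⟨x, hz⟩⟩)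
  rw [← he, (hf i).coheight_map]
  exact (Order.coheight_le_krullDim _).trans (h i)

namespace ProjLine

theorem topologicalKrullDim_le_of_chart {T : Set ProjLine} {n : WithBot ℕ∞}
    (h : ∀ σ, topologicalKrullDim (chart σ ⁻¹' T) ≤ n) : topologicalKrullDim T ≤ n := by
  refine topologicalKrullDim_le_of_isOpenEmbedding_cover
    (fun σ => (isOpenEmbedding_chart σ).restrictPreimage T) ?_ h
  rintro ⟨L, hL⟩
  obtain ⟨σ, x, rfl⟩ := exists_chart L
  exact ⟨σ, ⟨x, hL⟩, rfl⟩

theorem topologicalKrullDim_chart_preimage_le (σ : Equiv.Perm (Fin 4)) (T : Set ProjLine) :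
    topologicalKrullDim (chart σ ⁻¹' T) ≤ topologicalKrullDim T :=
  ((isOpenEmbedding_chart σ).restrictPreimage T).isInducing.topologicalKrullDim_le

end ProjLine

/-! ### Restriction of a form to a line -/

section Homogenize

variable {K : Type*} [Field K]

theorem eval_homogenize_one_zero (f : Polynomial K) (n : ℕ) :
    eval ![1, 0] (f.homogenize n) = f.coeff n := by
  rw [Polynomial.homogenize, map_sum, Finset.sum_eq_single (n, 0)]
  · simp [eval_monomial, Finsupp.prod_fintype]
  · rintro ⟨i, j⟩ hij hne
    have hj : j ≠ 0 := by
      rintro rfl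
      exact hne (by simpa using hij)
    simp [eval_monomial, Finsupp.prod_fintype, hj]
  · simp

theorem homogenize_X_sub_C_pow (r : K) (m : ℕ) :
    ((Polynomial.X - Polynomial.C r) ^ m).homogenize m = (X 0 - C r * X 1) ^ m := by
  refine Polynomial.homogenize_eq_of_isHomogeneous ?_ (by simp [Polynomial.C_eq_algebraMap])
  have h := ((isHomogeneous_X K (0 : Fin 2)).sub
    ((isHomogeneous_C (Fin 2) r).mul (isHomogeneous_X K 1))).pow m
  rwa [one_mul] at h

theorem eval_zero_aeval_homogenize {g A : Polynomial K} {n : ℕ} (hn : g.natDegree ≤ n)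
    (hA : A.eval 0 ≠ 0) (r γ : K) :
    (aeval ![Polynomial.C r * A + Polynomial.C γ * Polynomial.X, A] (g.homogenize n)).eval 0 =
      g.eval r * A.eval 0 ^ n := by
  have hev : (aeval ![Polynomial.C r * A + Polynomial.C γ * Polynomial.X, A]
      (g.homogenize n)).eval 0 = eval ![r * A.eval 0, A.eval 0] (g.homogenize n) := by
    rw [aeval_def, ← Polynomial.coe_evalRingHom, hom_eval₂, eval, ← coe_eval₂Hom]
    congr 1
    refine congrArg₂ _ ?_ ?_
    · ext; simp
    · ext i
      fin_cases i <;> simp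
  rw [hev, Polynomial.eval_homogenize hn _ (by simpa using hA)]
  simp [hA]

theorem rootMultiplicity_zero_aeval_homogenize {f A : Polynomial K} {d : ℕ}
    (hd : f.natDegree ≤ d) (hf : f ≠ 0) (hA : A.eval 0 ≠ 0) {γ : K} (hγ : γ ≠ 0) (r : K) :
    (aeval ![Polynomial.C r * A + Polynomial.C γ * Polynomial.X, A]
      (f.homogenize d)).rootMultiplicity 0 = f.rootMultiplicity r := by
  obtain ⟨g, hg, hgdvd⟩ := Polynomial.exists_eq_pow_rootMultiplicity_mul_and_not_dvd f hf r
  set m := f.rootMultiplicity r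
  have hgr : g.eval r ≠ 0 := fun h => hgdvd (Polynomial.dvd_iff_isRoot.2 h)
  have hg0 : g ≠ 0 := by
    rintro rfl
    simp at hgr
  have hdeg : m + g.natDegree = f.natDegree := by
    rw [hg, Polynomial.natDegree_mul (pow_ne_zero _ (Polynomial.X_sub_C_ne_zero r)) hg0,
      Polynomial.natDegree_pow, Polynomial.natDegree_X_sub_C, mul_one]
  have hgd : g.natDegree ≤ d - m := by omega
  have hhom : f.homogenize d = (X 0 - C r * X 1) ^ m * g.homogenize (d - m) := by
    conv_lhs => rw [hg, ← Nat.add_sub_cancel' (show m ≤ d by omega)]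
    rw [Polynomial.homogenize_mul _ _ (by simp) hgd, homogenize_X_sub_C_pow]
  let y : Fin 2 → Polynomial K := ![Polynomial.C r * A + Polynomial.C γ * Polynomial.X, A]
  let H : Polynomial K := aeval y (g.homogenize (d - m))
  have hH : H.eval 0 = g.eval r * A.eval 0 ^ (d - m) := eval_zero_aeval_homogenize hgd hA r γ
  have hfactor : aeval y (f.homogenize d) =
      (Polynomial.C (γ ^ m) * H) * (Polynomial.X - Polynomial.C 0) ^ m := by
    have hy : y 0 - Polynomial.C r * y 1 = Polynomial.C γ * Polynomial.X := by simp [y]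
    rw [hhom, map_mul, map_pow, map_sub, map_mul, aeval_X, aeval_X, aeval_C,
      ← Polynomial.C_eq_algebraMap, hy, mul_pow, Polynomial.C_pow, Polynomial.C_0, sub_zero]
    ring
  have hne : (Polynomial.C (γ ^ m) * H).eval 0 ≠ 0 := by
    simp [hH, hγ, hA, hgr]
  have hne0 : Polynomial.C (γ ^ m) * H ≠ 0 := fun h => hne (by rw [h, Polynomial.eval_zero])
  rw [hfactor, Polynomial.rootMultiplicity_mul_X_sub_C_pow hne0,
    Polynomial.rootMultiplicity_eq_zero hne, zero_add]

end Homogenize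

theorem eval_alongLine (F : MvPolynomial (Fin 4) ℂ) (a b : Fin 4 → ℂ) (t : ℂ) :
    (alongLine F a b).eval t = eval (a + t • b) F := by
  rw [alongLine, aeval_def, ← Polynomial.coe_evalRingHom, hom_eval₂, eval, ← coe_eval₂Hom]
  congr 1
  refine congrArg₂ _ ?_ ?_
  · ext; simp
  · ext i
    simp only [Polynomial.coe_evalRingHom, Polynomial.eval_add, Polynomial.eval_C,
      Polynomial.eval_mul, Polynomial.eval_X, Pi.add_apply, Pi.smul_apply, smul_eq_mul]
    ring

section Homogeneous

variable {d : ℕ} {F : MvPolynomial (Fin 4) ℂ} (hF : F.IsHomogeneous d)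
include hF

theorem natDegree_alongLine_le (a b : Fin 4 → ℂ) : (alongLine F a b).natDegree ≤ d :=
  (aeval_natDegree_le F hF.totalDegree_le _ fun _ => by compute_degree).trans_eq (mul_one d)

theorem aeval_homogenize_alongLine {A : Type*} [CommRing A] [Algebra ℂ A] (u v : Fin 4 → ℂ)
    (x y : A) : aeval ![y, x] ((alongLine F u v).homogenize d) =
      aeval (fun i => u i • x + v i • y) F := by
  let G : MvPolynomial (Fin 2) ℂ := aeval (fun i => C (u i) * X 1 + C (v i) * X 0) F
  have hG : G.IsHomogeneous d := by
    have h := hF.aeval (fun i => C (u i) * X 1 + C (v i) * X 0) (n := 1) fun i =>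
      (isHomogeneous_C_mul_X (u i) (1 : Fin 2)).add (isHomogeneous_C_mul_X (v i) 0)
    rwa [one_mul] at h
  have hGX : aeval ![Polynomial.X, 1] G = alongLine F u v := by
    simp only [G, alongLine, ← AlgHom.comp_apply]
    congr 1
    ext i : 1
    simp [Polynomial.C_eq_algebraMap]
  rw [Polynomial.homogenize_eq_of_isHomogeneous hG hGX]
  simp only [G, ← AlgHom.comp_apply]
  congr 1
  ext i : 1
  simp [Algebra.smul_def]

theorem eval_homogenize_alongLine (u v : Fin 4 → ℂ) (α β : ℂ) :
    eval ![β, α] ((alongLine F u v).homogenize d) = eval (α • u + β • v) F := by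
  have h := aeval_homogenize_alongLine hF u v α β
  rw [aeval_eq_eval, aeval_eq_eval] at h
  refine h.trans (congrArg (fun w => eval w F) (funext fun i => ?_))
  simp [mul_comm]

theorem coeff_alongLine (a b : Fin 4 → ℂ) : (alongLine F a b).coeff d = eval b F := by
  rw [← eval_homogenize_one_zero, eval_homogenize_alongLine hF, zero_smul, one_smul, zero_add]

theorem alongLine_ne_zero {a b : Fin 4 → ℂ} (hb : eval b F ≠ 0) : alongLine F a b ≠ 0 := by
  intro h
  rw [← coeff_alongLine hF a, h, Polynomial.coeff_zero] at hb
  exact hb rfl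

theorem eval_eq_zero_of_alongLine_eq_zero {a b : Fin 4 → ℂ} (h : alongLine F a b = 0)
    {w : Fin 4 → ℂ} (hw : w ∈ Submodule.span ℂ {a, b}) : eval w F = 0 := by
  obtain ⟨α, β, rfl⟩ := Submodule.mem_span_pair.1 hw
  rw [← eval_homogenize_alongLine hF, h, Polynomial.homogenize_zero, map_zero]

theorem rootMultiplicity_alongLine {u v : Fin 4 → ℂ} {s γ : ℂ} (hs : s ≠ 0) (hγ : γ ≠ 0)
    (h0 : alongLine F u v ≠ 0) (r α : ℂ) :
    (alongLine F (s • (u + r • v)) (α • (u + r • v) + γ • v)).rootMultiplicity 0 =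
      (alongLine F u v).rootMultiplicity r := by
  let A : Polynomial ℂ := Polynomial.C s + Polynomial.C α * Polynomial.X
  rw [← rootMultiplicity_zero_aeval_homogenize (A := A) (natDegree_alongLine_le hF u v) h0
    (by simpa [A] using hs) hγ, aeval_homogenize_alongLine hF, alongLine]
  have harg : (fun i => Polynomial.C ((s • (u + r • v)) i) +
      Polynomial.C ((α • (u + r • v) + γ • v) i) * Polynomial.X) =
      fun i => u i • A + v i • (Polynomial.C r * A + Polynomial.C γ * Polynomial.X) := by
    ext1 i
    simp only [A, Pi.add_apply, Pi.smul_apply, smul_eq_mul, map_add, map_mul,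
      Polynomial.smul_eq_C_mul]
    ring
  rw [harg]

end Homogeneous

/-! ### The partition of a line -/

section LinePoint

variable {K V : Type*} [Field K] [AddCommGroup V] [Module K V] {u v : V}
  (hind : LinearIndependent K ![u, v])

include hind in
theorem add_smul_ne_zero (r : K) : u + r • v ≠ 0 := fun h =>
  one_ne_zero (hind.eq_zero_of_pair (s := 1) (t := r) (by rw [one_smul, h])).1

/-- The point `u + r v` of the projective line spanned by `u` and `v`; only the point `v` is not of
this form. -/
noncomputable def linePoint (r : K) : ℙ K V :=
  Projectivization.mk K (u + r • v) (add_smul_ne_zero hind r)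

theorem submodule_linePoint (r : K) :
    (linePoint hind r).submodule = Submodule.span K {u + r • v} := rfl

theorem exists_rep_linePoint (r : K) :
    ∃ s : K, s ≠ 0 ∧ (linePoint hind r).rep = s • (u + r • v) := by
  obtain ⟨s, hs⟩ := Projectivization.exists_smul_eq_mk_rep K (u + r • v) (add_smul_ne_zero hind r)
  exact ⟨s, s.ne_zero, hs.symm⟩

theorem linePoint_injective : Function.Injective (linePoint hind) := by
  intro r r' h
  obtain ⟨s, hs⟩ := (Projectivization.mk_eq_mk_iff' K _ _ _ _).1 h
  obtain ⟨hs1, hr⟩ := hind.eq_of_pair (s := s) (t := s * r') (s' := 1) (t' := r) (by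
    rw [mul_smul, ← smul_add, hs, one_smul])
  rw [← hr, hs1, one_mul]

theorem notMem_submodule_linePoint (r : K) : v ∉ (linePoint hind r).submodule := by
  rw [submodule_linePoint, Submodule.mem_span_singleton]
  rintro ⟨c, hc⟩
  obtain ⟨rfl, hcr⟩ := hind.eq_of_pair (s := c) (t := c * r) (s' := 0) (t' := 1) (by
    rw [mul_smul, ← smul_add, hc, zero_smul, one_smul, zero_add])
  simp at hcr

theorem exists_eq_of_notMem_submodule_linePoint {r : K} {b : V}
    (hb : b ∈ Submodule.span K {u, v}) (hbr : b ∉ (linePoint hind r).submodule) :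
    ∃ α γ : K, γ ≠ 0 ∧ b = α • (u + r • v) + γ • v := by
  obtain ⟨α, β, rfl⟩ := Submodule.mem_span_pair.1 hb
  have hb' : α • u + β • v = α • (u + r • v) + (β - α * r) • v := by module
  refine ⟨α, β - α * r, fun h => hbr ?_, hb'⟩
  rw [hb', h, zero_smul, add_zero, submodule_linePoint]
  exact Submodule.smul_mem _ _ (Submodule.mem_span_singleton_self _)

theorem submodule_linePoint_le (r : K) :
    (linePoint hind r).submodule ≤ Submodule.span K {u, v} := by
  rw [submodule_linePoint, Submodule.span_singleton_le_iff_mem]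
  exact Submodule.mem_span_pair.2 ⟨1, r, by rw [one_smul]⟩

theorem exists_linePoint_eq {q : ℙ K V} (hq : q.submodule ≤ Submodule.span K {u, v})
    (hv : v ∉ q.submodule) : ∃ r, linePoint hind r = q := by
  rw [q.submodule_eq] at hq hv
  obtain ⟨α, β, hαβ⟩ := Submodule.mem_span_pair.1 (hq (Submodule.mem_span_singleton_self _))
  have hα : α ≠ 0 := by
    rintro rfl
    rw [zero_smul, zero_add] at hαβ
    have hβ : β ≠ 0 := by
      rintro rfl
      exact q.rep_nonzero (by rw [← hαβ, zero_smul])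
    exact hv (Submodule.mem_span_singleton.2 ⟨β⁻¹, by rw [← hαβ, inv_smul_smul₀ hβ]⟩)
  refine ⟨β / α, ?_⟩
  rw [← q.mk_rep]
  refine (Projectivization.mk_eq_mk_iff' K _ _ _ _).2 ⟨α⁻¹, ?_⟩
  rw [← hαβ, smul_add, smul_smul, smul_smul, inv_mul_cancel₀ hα, one_smul, div_eq_inv_mul]

end LinePoint

/-- The multiset of the multiplicities of the distinct roots of a polynomial. -/
noncomputable def rootPartition {R : Type*} [CommRing R] [IsDomain R] [DecidableEq R]
    (f : Polynomial R) : Multiset ℕ :=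
  f.roots.toFinset.val.map fun r => f.rootMultiplicity r

theorem card_rootPartition {R : Type*} [CommRing R] [IsDomain R] [DecidableEq R]
    (f : Polynomial R) : (rootPartition f).card = f.roots.toFinset.card :=
  Multiset.card_map _ _

namespace Surface

variable {d : ℕ} (X : Surface d)

theorem isHomogeneous_form : X.form.IsHomogeneous d :=
  (mem_homogeneousSubmodule d _).1 (Projectivization.rep X).2

variable {L : ProjLine} {u v : Fin 4 → ℂ} (hL : Submodule.span ℂ {u, v} = L.1)
  (hind : LinearIndependent ℂ ![u, v])

theorem eval_rep_linePoint (r : ℂ) :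
    eval (linePoint hind r).rep X.form = 0 ↔ (alongLine X.form u v).IsRoot r := by
  obtain ⟨s, hs, hrep⟩ := exists_rep_linePoint hind r
  rw [hrep, eval_smul_of_isHomogeneous X.isHomogeneous_form, Polynomial.IsRoot, eval_alongLine]
  simp [hs]

include hL

theorem linePoint_mem_inter {r : ℂ} (h : (alongLine X.form u v).IsRoot r) :
    linePoint hind r ∈ X.inter L :=
  ⟨hL ▸ submodule_linePoint_le hind r, (X.eval_rep_linePoint hind r).2 h⟩

theorem interMult_linePoint (h0 : alongLine X.form u v ≠ 0) (r : ℂ) :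
    X.interMult L (linePoint hind r) = (alongLine X.form u v).rootMultiplicity r := by
  obtain ⟨s, hs, hrep⟩ := exists_rep_linePoint hind r
  have hmult {b : Fin 4 → ℂ} (hb : b ∈ L.1) (hbr : b ∉ (linePoint hind r).submodule) :
      (alongLine X.form (linePoint hind r).rep b).rootMultiplicity 0 =
        (alongLine X.form u v).rootMultiplicity r := by
    obtain ⟨α, γ, hγ, rfl⟩ := exists_eq_of_notMem_submodule_linePoint hind (hL ▸ hb) hbr
    rw [hrep, rootMultiplicity_alongLine X.isHomogeneous_form hs hγ h0]
  have hv : v ∈ L.1 := hL ▸ Submodule.mem_span_of_mem (.inr rfl)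
  have hset : {m | ∃ b ∈ L.1, b ∉ (linePoint hind r).submodule ∧
      m = (alongLine X.form (linePoint hind r).rep b).rootMultiplicity 0} =
      {(alongLine X.form u v).rootMultiplicity r} := by
    ext m
    constructor
    · rintro ⟨b, hb, hbr, rfl⟩
      exact hmult hb hbr
    · rintro rfl
      exact ⟨v, hv, notMem_submodule_linePoint hind r,
        (hmult hv (notMem_submodule_linePoint hind r)).symm⟩
  rw [interMult, hset, csInf_singleton]

theorem bijOn_linePoint (hv : eval v X.form ≠ 0) :
    Set.BijOn (linePoint hind) ((alongLine X.form u v).roots.toFinset : Set ℂ) (X.inter L) := by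
  have h0 : alongLine X.form u v ≠ 0 := alongLine_ne_zero X.isHomogeneous_form hv
  refine ⟨fun r hr => X.linePoint_mem_inter hL hind ?_, (linePoint_injective hind).injOn, ?_⟩
  · simpa [h0] using hr
  · rintro q ⟨hqL, hq⟩
    have hvq : v ∉ q.submodule := by
      rw [q.submodule_eq, Submodule.mem_span_singleton]
      rintro ⟨c, rfl⟩
      rw [eval_smul_of_isHomogeneous X.isHomogeneous_form, hq, mul_zero] at hv
      exact hv rfl
    obtain ⟨r, rfl⟩ := exists_linePoint_eq hind (hqL.trans hL.ge) hvq
    exact ⟨r, by simpa [h0] using (X.eval_rep_linePoint hind r).1 hq, rfl⟩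

include hind in
theorem interPartition_eq (hv : eval v X.form ≠ 0) :
    X.interPartition L = rootPartition (alongLine X.form u v) := by
  have h0 : alongLine X.form u v ≠ 0 := alongLine_ne_zero X.isHomogeneous_form hv
  calc X.interPartition L
      = ∑ᶠ r ∈ ((alongLine X.form u v).roots.toFinset : Set ℂ),
          ({(alongLine X.form u v).rootMultiplicity r} : Multiset ℕ) :=
        (finsum_mem_eq_of_bijOn (linePoint hind) (X.bijOn_linePoint hL hind hv)
          fun r _ => by rw [X.interMult_linePoint hL hind h0]).symm
    _ = rootPartition (alongLine X.form u v) := by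
        rw [finsum_mem_coe_finset, rootPartition, Finset.sum]
        conv_rhs => rw [← Multiset.sum_map_singleton (Multiset.map _ _), Multiset.map_map]
        rfl

end Surface

/-! ### Polynomials with prescribed root multiplicities -/

section ProdRoots

variable {R ι : Type*} [CommRing R] [Fintype ι]

/-- The monic polynomial with roots `r i` of multiplicities `μ i` (added up where the `r i`
coincide). -/
noncomputable def prodRoots (μ : ι → ℕ) (r : ι → R) : Polynomial R :=
  ∏ i, (Polynomial.X - Polynomial.C (r i)) ^ μ i

theorem monic_prodRoots (μ : ι → ℕ) (r : ι → R) : (prodRoots μ r).Monic :=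
  Polynomial.monic_prod_of_monic _ _ fun _ _ => (Polynomial.monic_X_sub_C _).pow _

theorem natDegree_prodRoots [Nontrivial R] (μ : ι → ℕ) (r : ι → R) :
    (prodRoots μ r).natDegree = ∑ i, μ i := by
  rw [prodRoots, Polynomial.natDegree_prod_of_monic _ _
    fun _ _ => (Polynomial.monic_X_sub_C _).pow _]
  simp [(Polynomial.monic_X_sub_C _).natDegree_pow]

theorem map_prodRoots {S : Type*} [CommRing S] (f : R →+* S) (μ : ι → ℕ) (r : ι → R) :
    (prodRoots μ r).map f = prodRoots μ fun i => f (r i) := by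
  simp [prodRoots, Polynomial.map_prod]

theorem eval_prodRoots {μ : ι → ℕ} (r : ι → R) {i : ι} (hi : 0 < μ i) :
    (prodRoots μ r).eval (r i) = 0 := by
  rw [prodRoots, Polynomial.eval_prod]
  exact Finset.prod_eq_zero (Finset.mem_univ i) (by simp [hi.ne'])

variable [IsDomain R]

theorem roots_prodRoots (μ : ι → ℕ) (r : ι → R) : (prodRoots μ r).roots = ∑ i, μ i • {r i} := by
  rw [prodRoots, Polynomial.roots_prod]
  · simp only [Polynomial.roots_pow, Polynomial.roots_X_sub_C]
    rfl
  · exact Finset.prod_ne_zero_iff.2 fun i _ => pow_ne_zero _ (Polynomial.X_sub_C_ne_zero _)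

variable [DecidableEq R] {μ : ι → ℕ} (hμ : ∀ i, 0 < μ i)
include hμ

theorem toFinset_roots_prodRoots (r : ι → R) :
    (prodRoots μ r).roots.toFinset = Finset.univ.image r := by
  ext z
  rw [Multiset.mem_toFinset, roots_prodRoots, Multiset.mem_sum]
  simp only [Finset.mem_univ, true_and, Finset.mem_image]
  refine exists_congr fun i => ?_
  rw [Multiset.mem_nsmul, Multiset.mem_singleton]
  exact ⟨fun h => h.2.symm, fun h => ⟨(hμ i).ne', h.symm⟩⟩

theorem rootPartition_prodRoots {r : ι → R} (hr : Function.Injective r) :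
    rootPartition (prodRoots μ r) = Finset.univ.val.map μ := by
  rw [rootPartition, toFinset_roots_prodRoots hμ, Finset.image_val_of_injOn hr.injOn,
    Multiset.map_map]
  refine Multiset.map_congr rfl fun i _ => ?_
  rw [Function.comp_apply, ← Polynomial.count_roots, roots_prodRoots, Multiset.count_sum',
    Finset.sum_eq_single i]
  · simp
  · intro j _ hj
    rw [Multiset.count_nsmul, Multiset.count_singleton, if_neg (fun h => hj (hr h).symm), mul_zero]
  · simp

theorem card_rootPartition_prodRoots_le (r : ι → R) :
    (rootPartition (prodRoots μ r)).card ≤ Fintype.card ι := by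
  rw [card_rootPartition, toFinset_roots_prodRoots hμ]
  exact Finset.card_image_le

theorem rootPartition_prodRoots_of_card_le {r : ι → R}
    (hr : Fintype.card ι ≤ (rootPartition (prodRoots μ r)).card) :
    rootPartition (prodRoots μ r) = Finset.univ.val.map μ := by
  rw [card_rootPartition, toFinset_roots_prodRoots hμ] at hr
  refine rootPartition_prodRoots hμ ?_
  rw [← Set.injOn_univ, ← Finset.coe_univ, ← Finset.card_image_iff]
  exact Finset.card_image_le.antisymm hr

end ProdRoots

section RootPartition

variable {K : Type*} [Field K] [DecidableEq K]

theorem rootPartition_integralNormalization (f : Polynomial K) :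
    rootPartition f.integralNormalization = rootPartition f := by
  rcases eq_or_ne f 0 with rfl | hf
  · rw [Polynomial.integralNormalization_zero]
  have ha : f.leadingCoeff ≠ 0 := Polynomial.leadingCoeff_ne_zero.2 hf
  have hroots : f.integralNormalization.roots = f.roots.map (f.leadingCoeff * ·) := by
    rw [← Polynomial.roots_scaleRoots f ha.isUnit,
      ← Polynomial.leadingCoeff_smul_integralNormalization, Polynomial.roots_smul_nonzero _ ha]
  have hinj : Function.Injective (f.leadingCoeff * ·) := mul_right_injective₀ ha
  simp only [rootPartition, ← Polynomial.count_roots, hroots, Multiset.toFinset_val]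
  rw [Multiset.dedup_map_of_injective hinj, Multiset.map_map]
  exact Multiset.map_congr rfl fun r _ => Multiset.count_map_eq_count' _ _ hinj r

theorem pos_of_mem_rootPartition {f : Polynomial K} {n : ℕ} (hn : n ∈ rootPartition f) : 0 < n := by
  obtain ⟨r, hr, rfl⟩ := Multiset.mem_map.1 hn
  rw [← Polynomial.count_roots, Multiset.count_pos]
  exact Multiset.mem_toFinset.1 hr

variable [IsAlgClosed K]

theorem sum_rootPartition (f : Polynomial K) : (rootPartition f).sum = f.natDegree := by
  rw [← IsAlgClosed.card_roots_eq_natDegree, ← Multiset.toFinset_sum_count_eq]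
  simp only [Polynomial.count_roots]
  rfl

theorem exists_eq_C_mul_prodRoots (f : Polynomial K) :
    ∃ (μ : Fin (rootPartition f).card → ℕ) (r : Fin (rootPartition f).card → K),
      Finset.univ.val.map μ = rootPartition f ∧
        f = Polynomial.C f.leadingCoeff * prodRoots μ r := by
  let e := (Finset.equivFinOfCardEq (card_rootPartition f).symm).symm
  refine ⟨fun i => f.rootMultiplicity (e i : K), fun i => (e i : K), ?_, ?_⟩
  · calc Finset.univ.val.map (fun i => f.rootMultiplicity (e i : K))
        = (Finset.univ.val.map e).map fun r : f.roots.toFinset => f.rootMultiplicity (r : K) := by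
          rw [Multiset.map_map]; rfl
      _ = rootPartition f := by
          rw [Multiset.map_univ_val_equiv, rootPartition]
          exact Multiset.attach_map_val' _ fun r => f.rootMultiplicity r
  · have hprod : (f.roots.map fun a => Polynomial.X - Polynomial.C a).prod =
        prodRoots (fun i => f.rootMultiplicity (e i : K)) fun i => (e i : K) := by
      rw [Finset.prod_multiset_map_count, prodRoots, ← Finset.prod_coe_sort, ← Equiv.prod_comp e]
      exact Finset.prod_congr rfl fun i _ => by rw [Polynomial.count_roots]
    rw [← hprod, Polynomial.C_leadingCoeff_mul_prod_multiset_X_sub_C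
      IsAlgClosed.card_roots_eq_natDegree]

end RootPartition

/-! ### Partitions with few parts different from one -/

theorem exists_eq_withOnes {d : ℕ} {p : Multiset ℕ} (hp : ∀ n ∈ p, 0 < n) (hsum : p.sum = d) :
    ∃ s : Multiset ℕ, (∀ n ∈ s, 2 ≤ n) ∧ p = withOnes d s ∧ s.sum + p.card = s.card + d := by
  obtain ⟨s, t, hst, hs, ht⟩ : ∃ s t : Multiset ℕ, s + t = p ∧ (∀ n ∈ s, 2 ≤ n) ∧
      t = Multiset.replicate t.card 1 := by
    refine ⟨p.filter (2 ≤ ·), p.filter (¬ 2 ≤ ·), Multiset.filter_add_not _ _,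
      fun n hn => (Multiset.mem_filter.1 hn).2, Multiset.eq_replicate_card.2 fun n hn => ?_⟩
    have hn' := Multiset.mem_filter.1 hn
    have := hp n hn'.1
    omega
  have htsum : t.sum = t.card := by
    rw [ht, Multiset.sum_replicate, Multiset.card_replicate, smul_eq_mul, mul_one]
  have hd : s.sum + t.card = d := by rw [← htsum, ← Multiset.sum_add, hst, hsum]
  refine ⟨s, hs, ?_, ?_⟩
  · rw [withOnes, ← hst, ← hd, Nat.add_sub_cancel_left, ← ht]
  · rw [← hst, Multiset.card_add]
    omega

theorem card_withOnes {d : ℕ} {s : Multiset ℕ} (h : s.sum ≤ d) :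
    (withOnes d s).card + s.sum = s.card + d := by
  rw [withOnes, Multiset.card_add, Multiset.card_replicate]
  omega

theorem sum_le_of_sum_withOnes_eq {d : ℕ} {s : Multiset ℕ} (h : (withOnes d s).sum = d) :
    s.sum ≤ d := by
  rw [withOnes, Multiset.sum_add] at h
  omega

theorem two_mul_card_le_sum {s : Multiset ℕ} (hs : ∀ n ∈ s, 2 ≤ n) : 2 * s.card ≤ s.sum := by
  rw [mul_comm, ← smul_eq_mul]
  exact Multiset.card_nsmul_le_sum hs

theorem eq_withOnes_zero_of_le_card {d : ℕ} {p : Multiset ℕ} (hp : ∀ n ∈ p, 0 < n)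
    (hsum : p.sum = d) (hcard : d ≤ p.card) : p = withOnes d 0 := by
  obtain ⟨s, hs, rfl, hds⟩ := exists_eq_withOnes hp hsum
  have := two_mul_card_le_sum hs
  rw [Multiset.card_eq_zero.1 (by omega : s.card = 0)]

theorem mem_of_sum_le_card_add_four {s : Multiset ℕ} (hs : ∀ n ∈ s, 2 ≤ n)
    (hsum : s.sum ≤ s.card + 4) :
    s ∈ ({0, {2}, {2, 2}, {3}, {2, 2, 2}, {3, 2}, {4},
          {2, 2, 2, 2}, {3, 2, 2}, {3, 3}, {4, 2}, {5}} : Set (Multiset ℕ)) := by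
  have hcount {a : ℕ} (ha : 2 ≤ a) : s.count a ≤ 4 / (a - 1) := by
    obtain ⟨u, hu⟩ := Multiset.le_iff_exists_add.1
      (Multiset.le_count_iff_replicate_le.1 (le_refl (s.count a)))
    have hucard := two_mul_card_le_sum fun n hn => hs n (hu ▸ Multiset.mem_add.2 (Or.inr hn))
    rw [hu, Multiset.sum_add, Multiset.card_add, Multiset.sum_replicate, Multiset.card_replicate,
      smul_eq_mul] at hsum
    rw [Nat.le_div_iff_mul_le (by omega), Nat.mul_sub_one]
    omega
  have hle : s ≤ {2, 2, 2, 2, 3, 3, 4, 5} := by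
    refine Multiset.le_iff_count.2 fun a => ?_
    by_cases ha : a ∈ s
    · refine (hcount (hs a ha)).trans ?_
      rcases lt_or_ge a 6 with h | h
      · interval_cases a <;> decide
      · rw [Nat.div_eq_of_lt (by omega)]
        exact Nat.zero_le _
    · rw [Multiset.count_eq_zero_of_notMem ha]
      exact Nat.zero_le _
  have hdecide : ∀ t ∈ Multiset.powerset ({2, 2, 2, 2, 3, 3, 4, 5} : Multiset ℕ),
      t.sum ≤ t.card + 4 →
      t = 0 ∨ t = {2} ∨ t = {2, 2} ∨ t = {3} ∨ t = {2, 2, 2} ∨ t = {3, 2} ∨ t = {4} ∨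
        t = {2, 2, 2, 2} ∨ t = {3, 2, 2} ∨ t = {3, 3} ∨ t = {4, 2} ∨ t = {5} := by
    decide +kernel
  exact hdecide s (Multiset.mem_powerset.2 hle) hsum

/-! ### Families of monic polynomials over an affine space -/

theorem map_eq_map_iff_of_monic {R R' S : Type*} [Semiring R] [Semiring R'] [Semiring S]
    {f : Polynomial R} {g : Polynomial R'} (hf : f.Monic) (hg : g.Monic)
    (hdeg : f.natDegree = g.natDegree) (φ : R →+* S) (ψ : R' →+* S) :
    f.map φ = g.map ψ ↔ ∀ j < g.natDegree, φ (f.coeff j) = ψ (g.coeff j) := by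
  simp only [Polynomial.ext_iff, Polynomial.coeff_map]
  refine ⟨fun h j _ => h j, fun h j => ?_⟩
  rcases lt_trichotomy j g.natDegree with hj | rfl | hj
  · exact h j hj
  · rw [hg.coeff_natDegree, ← hdeg, hf.coeff_natDegree, map_one, map_one]
  · rw [Polynomial.coeff_eq_zero_of_natDegree_lt hj,
      Polynomial.coeff_eq_zero_of_natDegree_lt (hdeg ▸ hj), map_zero, map_zero]

namespace ZariskiAffine

variable {K κ ι : Type*} [Field K] [Fintype ι] {h : Polynomial (MvPolynomial κ K)} {μ : ι → ℕ}

/-- The equations in the variables of `h` and in variables `r i` which say that the roots of `h` are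
the `r i`, with multiplicities `μ i`. -/
noncomputable def rootEquations (h : Polynomial (MvPolynomial κ K)) (μ : ι → ℕ) :
    Finset (MvPolynomial (κ ⊕ ι) K) := by
  classical
  exact (Finset.range h.natDegree).image fun j =>
    (prodRoots μ fun i => (X (Sum.inr i) : MvPolynomial (κ ⊕ ι) K)).coeff j -
      rename Sum.inl (h.coeff j)

theorem card_rootEquations_le : (rootEquations h μ).card ≤ h.natDegree := by
  classical
  exact Finset.card_image_le.trans_eq (Finset.card_range _)

theorem mem_projZeros_rootEquations_iff (hh : h.Monic) (hμ : ∑ i, μ i = h.natDegree)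
    {x : ZariskiAffine K κ} : x ∈ projZeros (rootEquations h μ) ↔
      ∃ r : ι → K, prodRoots μ r = h.map (eval x.coord) := by
  refine exists_congr fun r => ?_
  have hr : prodRoots μ r =
      (prodRoots μ fun i => X (Sum.inr i)).map (eval (Sum.elim x.coord r)) := by
    simp only [map_prodRoots, eval_X, Sum.elim_inr]
  rw [hr, map_eq_map_iff_of_monic (monic_prodRoots _ _) hh ((natDegree_prodRoots _ _).trans hμ)]
  simp only [rootEquations, Finset.forall_mem_image, Finset.mem_range, map_sub, sub_eq_zero,
    eval_rename, Sum.elim_comp_inl]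

theorem coverMap_rootEquations_isIntegral (hh : h.Monic) (hpos : ∀ i, 0 < μ i)
    (hμ : ∑ i, μ i = h.natDegree) : (coverMap (rootEquations h μ)).IsIntegral := by
  classical
  refine coverMap_isIntegral_of_isIntegralElem _ fun i => ⟨h, hh, ?_⟩
  have hmap : (prodRoots μ fun i => X (Sum.inr i)).map (coverMk (rootEquations h μ)) =
      h.map (coverMap (rootEquations h μ)) := by
    refine (map_eq_map_iff_of_monic (monic_prodRoots _ _) hh
      ((natDegree_prodRoots _ _).trans hμ) _ _).2 fun j hj => ?_
    rw [coverMap_apply, ← sub_eq_zero, ← map_sub]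
    exact coverMk_eq_zero _ (Finset.mem_image_of_mem _ (Finset.mem_range.2 hj))
  rw [← Polynomial.eval_map, ← hmap, map_prodRoots]
  exact eval_prodRoots (fun i => coverMk _ (X (Sum.inr i))) (hpos i)

theorem pos_of_map_eq {p : Multiset ℕ} (hpos : ∀ n ∈ p, 0 < n) (hμ : Finset.univ.val.map μ = p)
    (i : ι) : 0 < μ i :=
  hpos _ (hμ ▸ Multiset.mem_map_of_mem μ (Finset.mem_univ i))

theorem sum_eq_of_map_eq {p : Multiset ℕ} {d : ℕ} (hsum : p.sum = d)
    (hμ : Finset.univ.val.map μ = p) : ∑ i, μ i = d := by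
  rw [← hsum, ← hμ]
  rfl

/-- The points at which the roots of the family `h` have multiplicities `p`, where the roots may
coincide and their multiplicities then add up. -/
def multLocus (h : Polynomial (MvPolynomial κ K)) (p : Multiset ℕ) : Set (ZariskiAffine K κ) :=
  ⋃ μ ∈ {μ : Fin p.card → ℕ | Finset.univ.val.map μ = p}, projZeros (rootEquations h μ)

theorem isClosed_multLocus [IsAlgClosed K] [Finite κ] (hh : h.Monic) {p : Multiset ℕ}
    (hpos : ∀ n ∈ p, 0 < n) (hsum : p.sum = h.natDegree) : IsClosed (multLocus h p) := by
  refine Set.Finite.isClosed_biUnion ?_ fun μ hμ => isClosed_projZeros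
    (coverMap_rootEquations_isIntegral hh (pos_of_map_eq hpos hμ) (sum_eq_of_map_eq hsum hμ))
  refine (Set.finite_Iic fun _ => h.natDegree).subset fun μ hμ i => ?_
  rw [← sum_eq_of_map_eq hsum hμ]
  exact Finset.single_le_sum (fun _ _ => Nat.zero_le _) (Finset.mem_univ i)

variable [DecidableEq K] {p : Multiset ℕ} {x : ZariskiAffine K κ}

theorem mem_multLocus_rootPartition [IsAlgClosed K] (hh : h.Monic) (x : ZariskiAffine K κ) :
    x ∈ multLocus h (rootPartition (h.map (eval x.coord))) := by
  obtain ⟨μ, r, hμ, hr⟩ := exists_eq_C_mul_prodRoots (h.map (eval x.coord))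
  have hsum : ∑ i, μ i = h.natDegree :=
    sum_eq_of_map_eq (by rw [sum_rootPartition, hh.natDegree_map]) hμ
  refine Set.mem_biUnion hμ ((mem_projZeros_rootEquations_iff hh hsum).2 ⟨r, ?_⟩)
  rw [(hh.map _).leadingCoeff, map_one, one_mul] at hr
  exact hr.symm

theorem rootPartition_of_mem_multLocus (hh : h.Monic) (hpos : ∀ n ∈ p, 0 < n)
    (hsum : p.sum = h.natDegree) (hx : x ∈ multLocus h p) :
    (rootPartition (h.map (eval x.coord))).card ≤ p.card ∧
      (p.card ≤ (rootPartition (h.map (eval x.coord))).card →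
        rootPartition (h.map (eval x.coord)) = p) := by
  obtain ⟨μ, hμ, hxμ⟩ := Set.mem_iUnion₂.1 hx
  obtain ⟨r, hr⟩ := (mem_projZeros_rootEquations_iff hh (sum_eq_of_map_eq hsum hμ)).1 hxμ
  have hcard := card_rootPartition_prodRoots_le (pos_of_map_eq hpos hμ) r
  rw [← hr]
  refine ⟨by rwa [Fintype.card_fin] at hcard, fun hp => ?_⟩
  rw [rootPartition_prodRoots_of_card_le (pos_of_map_eq hpos hμ) (by rwa [Fintype.card_fin]), hμ]

variable [IsAlgClosed K]

theorem isOpen_setOf_le_card_rootPartition [Finite κ] (hh : h.Monic) (k : ℕ) :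
    IsOpen {x : ZariskiAffine K κ | k ≤ (rootPartition (h.map (eval x.coord))).card} := by
  have hcompl : {x : ZariskiAffine K κ | k ≤ (rootPartition (h.map (eval x.coord))).card}ᶜ =
      ⋃ q ∈ {q : h.natDegree.Partition | q.parts.card < k}, multLocus h q.parts := by
    ext x
    simp only [Set.mem_compl_iff, Set.mem_ofPred_eq, not_le, Set.mem_iUnion, exists_prop]
    refine ⟨fun hx => ⟨⟨_, pos_of_mem_rootPartition, ?_⟩, hx, mem_multLocus_rootPartition hh x⟩,
      fun ⟨q, hq, hx⟩ => ?_⟩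
    · rw [sum_rootPartition, hh.natDegree_map]
    · exact (rootPartition_of_mem_multLocus hh (fun n => q.parts_pos) q.parts_sum hx).1.trans_lt hq
  rw [← isClosed_compl_iff, hcompl]
  exact (Set.toFinite _).isClosed_biUnion fun q _ =>
    isClosed_multLocus hh (fun n => q.parts_pos) q.parts_sum

theorem setOf_rootPartition_eq (hh : h.Monic) (hpos : ∀ n ∈ p, 0 < n)
    (hsum : p.sum = h.natDegree) :
    {x : ZariskiAffine K κ | rootPartition (h.map (eval x.coord)) = p} =
      {x | p.card ≤ (rootPartition (h.map (eval x.coord))).card} ∩ multLocus h p := by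
  ext x
  refine ⟨?_, fun ⟨hp, hx⟩ => (rootPartition_of_mem_multLocus hh hpos hsum hx).2 hp⟩
  rintro rfl
  exact ⟨le_refl (Multiset.card _), mem_multLocus_rootPartition hh x⟩

theorem rootPartition_map_spec (hh : h.Monic) (hx : rootPartition (h.map (eval x.coord)) = p) :
    (∀ n ∈ p, 0 < n) ∧ p.sum = h.natDegree := by
  rw [← hx, sum_rootPartition, hh.natDegree_map]
  exact ⟨fun n => pos_of_mem_rootPartition, rfl⟩

theorem isLocallyClosed_setOf_rootPartition_eq [Finite κ] (hh : h.Monic) (p : Multiset ℕ) :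
    IsLocallyClosed {x : ZariskiAffine K κ | rootPartition (h.map (eval x.coord)) = p} := by
  rcases Set.eq_empty_or_nonempty
    {x : ZariskiAffine K κ | rootPartition (h.map (eval x.coord)) = p} with hp | ⟨x, hx⟩
  · rw [hp]
    exact isClosed_empty.isLocallyClosed
  · obtain ⟨hpos, hsum⟩ := rootPartition_map_spec hh hx
    rw [setOf_rootPartition_eq hh hpos hsum]
    exact (isOpen_setOf_le_card_rootPartition hh _).isLocallyClosed.inter
      (isClosed_multLocus hh hpos hsum).isLocallyClosed

theorem le_topologicalKrullDim_setOf_rootPartition_eq_inter [Fintype κ] (hh : h.Monic)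
    (hx : rootPartition (h.map (eval x.coord)) = p) {O : Set (ZariskiAffine K κ)} (hO : IsOpen O)
    (hxO : x ∈ O) {n : ℕ} (hn : n + h.natDegree ≤ Fintype.card κ + p.card) :
    n ≤ topologicalKrullDim
      ({x | rootPartition (h.map (eval x.coord)) = p} ∩ O : Set (ZariskiAffine K κ)) := by
  obtain ⟨hpos, hsum⟩ := rootPartition_map_spec hh hx
  obtain ⟨μ, hμ, hxμ⟩ := Set.mem_iUnion₂.1 (hx ▸ mem_multLocus_rootPartition hh x)
  have hle : n ≤ topologicalKrullDim (projZeros (rootEquations h μ) ∩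
      ({x | p.card ≤ (rootPartition (h.map (eval x.coord))).card} ∩ O) : Set _) := by
    refine le_topologicalKrullDim_projZeros_inter
      (coverMap_rootEquations_isIntegral hh (pos_of_map_eq hpos hμ) (sum_eq_of_map_eq hsum hμ))
      ((isOpen_setOf_le_card_rootPartition hh _).inter hO) hxμ ⟨hx ▸ le_refl p.card, hxO⟩ ?_
    rw [Fintype.card_fin]
    exact (Nat.add_le_add_left card_rootEquations_le _).trans hn
  refine hle.trans (IsEmbedding.inclusion ?_).isInducing.topologicalKrullDim_le
  rw [setOf_rootPartition_eq hh hpos hsum]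
  exact fun y ⟨hy, hyp, hyO⟩ => ⟨⟨hyp, Set.mem_biUnion hμ hy⟩, hyO⟩

end ZariskiAffine

theorem isLocallyClosed_of_forall_exists_isOpen {Y : Type*} [TopologicalSpace Y] {T : Set Y}
    (h : ∀ y ∈ T, ∃ U, IsOpen U ∧ y ∈ U ∧ IsLocallyClosed (T ∩ U)) : IsLocallyClosed T := by
  refine ((isLocallyClosed_tfae T).out 0 3).2 fun y hy => ?_
  obtain ⟨U, hU, hyU, V, C, hV, hC, hTU⟩ := h y hy
  have hmem {z : Y} : z ∈ T ∧ z ∈ U ↔ z ∈ V ∧ z ∈ C := Set.ext_iff.1 hTU z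
  refine ⟨U ∩ V, ⟨hyU, (hmem.1 ⟨hy, hyU⟩).1⟩, hU.inter hV, fun z hz => ?_⟩
  have hsub : U ∩ V ∩ T ⊆ C := fun w ⟨⟨hwU, _⟩, hwT⟩ => (hmem.1 ⟨hwT, hwU⟩).2
  have hzC : z ∈ C := closure_minimal hsub hC ((hU.inter hV).inter_closure hz)
  exact (hmem.2 ⟨hz.1.2, hzC⟩).1

/-! ### The strata of a surface -/

namespace ProjLine

/-- The restriction of the form `F` to the lines of a chart, as a polynomial with coefficients in
the coordinate ring of the chart. The parameter `τ` selects the point at infinity of the lines. -/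
noncomputable def familyLine (F : MvPolynomial (Fin 4) ℂ) (σ : Equiv.Perm (Fin 4)) (τ : ℂ) :
    Polynomial (MvPolynomial (Fin 4) ℂ) :=
  aeval (fun i => Polynomial.C (chartFst σ X i) +
    Polynomial.C (chartSnd σ X i + C τ * chartFst σ X i) * Polynomial.X) F

theorem map_familyLine (F : MvPolynomial (Fin 4) ℂ) (σ : Equiv.Perm (Fin 4)) (τ : ℂ)
    (x : Fin 4 → ℂ) : (familyLine F σ τ).map (eval x) =
      alongLine F (chartFst σ x) (chartSnd σ x + τ • chartFst σ x) := by
  have hX : eval x ∘ X = x := funext fun i => eval_X i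
  rw [familyLine, alongLine, aeval_def, aeval_def, ← Polynomial.coe_mapRingHom, hom_eval₂]
  congr 1
  · ext a
    simp
  · ext i : 1
    have hFst : eval x (chartFst σ X i) = chartFst σ x i := by rw [map_chartFst, hX]
    have hSnd : eval x (chartSnd σ X i) = chartSnd σ x i := by rw [map_chartSnd, hX]
    simp only [map_add, map_mul, Polynomial.coe_mapRingHom, Polynomial.map_C, Polynomial.map_X,
      hFst, hSnd, eval_C, Pi.add_apply, Pi.smul_apply, smul_eq_mul]

theorem natDegree_familyLine_le {F : MvPolynomial (Fin 4) ℂ} {d : ℕ} (hF : F.IsHomogeneous d)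
    (σ : Equiv.Perm (Fin 4)) (τ : ℂ) : (familyLine F σ τ).natDegree ≤ d := by
  refine Polynomial.natDegree_le_iff_coeff_eq_zero.2 fun j hj => MvPolynomial.funext fun x => ?_
  rw [← Polynomial.coeff_map, map_familyLine, map_zero]
  exact Polynomial.coeff_eq_zero_of_natDegree_lt ((natDegree_alongLine_le hF _ _).trans_lt hj)

theorem linearIndependent_chart_add_smul (σ : Equiv.Perm (Fin 4)) (τ : ℂ) (x : Fin 4 → ℂ) :
    LinearIndependent ℂ ![chartFst σ x, chartSnd σ x + τ • chartFst σ x] := by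
  have hind := linearIndependent_chart σ x
  rw [LinearIndependent.pair_iff] at hind ⊢
  intro s t hst
  obtain ⟨hs, rfl⟩ := hind (s + t * τ) t (by rw [← hst]; module)
  exact ⟨by simpa using hs, rfl⟩

theorem span_chart_add_smul (σ : Equiv.Perm (Fin 4)) (τ : ℂ) (x : ZariskiAffine ℂ (Fin 4)) :
    Submodule.span ℂ {chartFst σ x.coord, chartSnd σ x.coord + τ • chartFst σ x.coord} =
      (chart σ x).1 := by
  refine Submodule.eq_of_le_of_finrank_eq ?_ ((finrank_span_pair
    (linearIndependent_chart_add_smul σ τ x.coord)).trans (chart σ x).2.symm)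
  rw [Submodule.span_le]
  rintro w (rfl | rfl)
  · exact Submodule.subset_span (.inl rfl)
  · exact Submodule.mem_span_pair.2 ⟨τ, 1, by rw [one_smul, add_comm]⟩

end ProjLine

namespace Surface

open ProjLine

variable {d : ℕ} {X : Surface d} {L : ProjLine}

theorem exists_chart_eval_ne_zero (hL : ¬ X.ContainsLine L) :
    ∃ (σ : Equiv.Perm (Fin 4)) (τ : ℂ) (x : ZariskiAffine ℂ (Fin 4)), chart σ x = L ∧
      eval (chartSnd σ x.coord + τ • chartFst σ x.coord) X.form ≠ 0 := by
  obtain ⟨σ, x, rfl⟩ := exists_chart L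
  by_contra! hcon
  have h0 : alongLine X.form (chartSnd σ x.coord) (chartFst σ x.coord) = 0 :=
    Polynomial.funext fun τ => by
      rw [eval_alongLine, hcon σ τ x rfl, Polynomial.eval_zero]
  refine hL fun w hw => eval_eq_zero_of_alongLine_eq_zero X.isHomogeneous_form h0 ?_
  rw [Set.pair_comm]
  exact hw

theorem exists_chart_rootPartition (hL : ¬ X.ContainsLine L) :
    ∃ (σ : Equiv.Perm (Fin 4)) (x : ZariskiAffine ℂ (Fin 4)) (O : Set (ZariskiAffine ℂ (Fin 4)))
      (h : Polynomial (MvPolynomial (Fin 4) ℂ)), chart σ x = L ∧ x ∈ O ∧ IsOpen O ∧ h.Monic ∧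
        h.natDegree = d ∧
        ∀ y ∈ O, X.interPartition (chart σ y) = rootPartition (h.map (eval y.coord)) := by
  obtain ⟨σ, τ, x, hx, hne⟩ := exists_chart_eval_ne_zero hL
  set f := familyLine X.form σ τ
  have hlead (y : ZariskiAffine ℂ (Fin 4)) : eval y.coord (f.coeff d) =
      eval (chartSnd σ y.coord + τ • chartFst σ y.coord) X.form := by
    rw [← Polynomial.coeff_map, map_familyLine, coeff_alongLine X.isHomogeneous_form]
  have hfd : f.coeff d ≠ 0 := fun h0 => hne (by rw [← hlead, h0, map_zero])
  have hdeg : f.natDegree = d := (natDegree_familyLine_le X.isHomogeneous_form σ τ).antisymm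
    (Polynomial.le_natDegree_of_ne_zero hfd)
  have hf0 : f ≠ 0 := fun h0 => hfd (by rw [h0, Polynomial.coeff_zero])
  refine ⟨σ, x, ZariskiAffine.nonvanishing (f.coeff d), f.integralNormalization, hx,
    (hlead x).trans_ne hne, ZariskiAffine.isOpen_nonvanishing _,
    Polynomial.monic_integralNormalization hf0,
    Polynomial.natDegree_integralNormalization.trans hdeg, fun y hy => ?_⟩
  have hy' : eval y.coord f.leadingCoeff ≠ 0 := by rwa [Polynomial.leadingCoeff, hdeg]
  rw [← Polynomial.integralNormalization_map _ _ hy', rootPartition_integralNormalization,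
    map_familyLine]
  exact X.interPartition_eq (span_chart_add_smul σ τ y)
    (linearIndependent_chart_add_smul σ τ y.coord) ((hlead y).symm.trans_ne hy)

theorem interPartition_spec (hL : ¬ X.ContainsLine L) :
    (∀ n ∈ X.interPartition L, 0 < n) ∧ (X.interPartition L).sum = d := by
  obtain ⟨σ, x, O, h, rfl, hx, -, hh, rfl, hO⟩ := exists_chart_rootPartition hL
  exact ZariskiAffine.rootPartition_map_spec hh (hO x hx).symm

theorem card_interPartition (hL : ¬ X.ContainsLine L) :
    (X.inter L).Finite ∧ (X.interPartition L).card = (X.inter L).ncard := by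
  obtain ⟨σ, τ, x, rfl, hx⟩ := exists_chart_eval_ne_zero hL
  have hspan := span_chart_add_smul σ τ x
  have hind := linearIndependent_chart_add_smul σ τ x.coord
  have hbij := X.bijOn_linePoint hspan hind hx
  refine ⟨hbij.image_eq ▸ (Finset.finite_toSet _).image _, ?_⟩
  rw [X.interPartition_eq hspan hind hx, card_rootPartition, ← hbij.image_eq,
    hbij.injOn.ncard_image, Set.ncard_coe_finset]

theorem card_roots_le_card_interPartition (hL : ¬ X.ContainsLine L) {u v : Fin 4 → ℂ}
    (hspan : Submodule.span ℂ {u, v} = L.1) (hind : LinearIndependent ℂ ![u, v]) :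
    (alongLine X.form u v).roots.toFinset.card ≤ (X.interPartition L).card := by
  obtain ⟨hfin, hcard⟩ := card_interPartition hL
  rw [hcard, ← Set.ncard_coe_finset]
  refine Set.ncard_le_ncard_of_injOn (linePoint hind) (fun r hr => ?_)
    (linePoint_injective hind).injOn hfin
  exact X.linePoint_mem_inter hspan hind
    (Polynomial.isRoot_of_mem_roots (Multiset.mem_toFinset.1 hr))

variable (hX : ∀ L, ¬ X.ContainsLine L)
include hX

theorem isLocallyClosed_stratum (s : Multiset ℕ) : IsLocallyClosed (X.stratum s) := by
  refine isLocallyClosed_of_forall_exists_isOpen fun L _ => ?_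
  obtain ⟨σ, x, O, h, rfl, hxO, hO, hh, rfl, hpart⟩ := exists_chart_rootPartition (hX L)
  have hemb := isOpenEmbedding_chart σ
  have himage : X.stratum s ∩ chart σ '' O =
      chart σ '' ({y | rootPartition (h.map (eval y.coord)) = withOnes h.natDegree s} ∩ O) := by
    ext L
    constructor
    · rintro ⟨hL, y, hy, rfl⟩
      exact ⟨y, ⟨(hpart y hy).symm.trans hL, hy⟩, rfl⟩
    · rintro ⟨y, ⟨hys, hy⟩, rfl⟩
      exact ⟨(hpart y hy).trans hys, y, hy, rfl⟩
  refine ⟨chart σ '' O, hemb.isOpenMap O hO, ⟨x, hxO, rfl⟩, himage ▸ ?_⟩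
  exact ((ZariskiAffine.isLocallyClosed_setOf_rootPartition_eq hh _).inter hO.isLocallyClosed).image
    hemb.isInducing hemb.isOpen_range.isLocallyClosed

theorem le_topologicalKrullDim_stratum_inter {s : Multiset ℕ} (hL : L ∈ X.stratum s)
    {O : Set ProjLine} (hO : IsOpen O) (hLO : L ∈ O) {n : ℕ} (hn : n + s.sum ≤ 4 + s.card) :
    n ≤ topologicalKrullDim (X.stratum s ∩ O : Set ProjLine) := by
  have hsd : s.sum ≤ d :=
    sum_le_of_sum_withOnes_eq ((congrArg Multiset.sum hL).symm.trans (interPartition_spec (hX L)).2)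
  have hcard := card_withOnes hsd
  obtain ⟨σ, x, V, h, rfl, hxV, hV, hh, rfl, hpart⟩ := exists_chart_rootPartition (hX L)
  have hle := ZariskiAffine.le_topologicalKrullDim_setOf_rootPartition_eq_inter hh
    ((hpart x hxV).symm.trans hL) (hV.inter (hO.preimage (continuous_chart σ))) ⟨hxV, hLO⟩
    (n := n) (by rw [Fintype.card_fin]; omega)
  refine hle.trans (le_trans ?_ (topologicalKrullDim_chart_preimage_le σ _))
  refine (IsEmbedding.inclusion fun y hy => ?_).isInducing.topologicalKrullDim_le
  obtain ⟨hy, hyV, hyO⟩ := hy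
  exact ⟨(hpart y hyV).trans hy, hyO⟩

theorem isOpen_stratum_zero : IsOpen (X.stratum 0) := by
  refine isOpen_iff_forall_mem_open.2 fun L hL => ?_
  obtain ⟨σ, x, O, h, rfl, hxO, hO, hh, rfl, hpart⟩ := exists_chart_rootPartition (hX L)
  refine ⟨_, ?_, (isOpenEmbedding_chart σ).isOpenMap _
    ((ZariskiAffine.isOpen_setOf_le_card_rootPartition hh h.natDegree).inter hO),
    ⟨x, ⟨?_, hxO⟩, rfl⟩⟩
  · rintro _ ⟨y, ⟨hcard, hy⟩, rfl⟩
    obtain ⟨hpos, hsum⟩ := interPartition_spec (hX (chart σ y))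
    exact eq_withOnes_zero_of_le_card hpos hsum ((hpart y hy).symm ▸ hcard)
  · have hx : rootPartition (h.map (eval x.coord)) = withOnes h.natDegree 0 :=
      (hpart x hxO).symm.trans hL
    rw [Set.mem_ofPred_eq, hx, withOnes, zero_add, Multiset.card_replicate, Multiset.sum_zero,
      Nat.sub_zero]

end Surface

/-! ### Elimination of parameters -/

section Elimination

variable {K ι ρ τ : Type*} [Field K]

theorem exists_aeval_eq_zero_of_card_lt [Fintype ι] [Fintype τ] (f : ι → MvPolynomial τ K)
    (hcard : Fintype.card τ < Fintype.card ι) :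
    ∃ Q : MvPolynomial ι K, Q ≠ 0 ∧ aeval f Q = 0 := by
  have hdep : ¬ AlgebraicIndependent K f := fun hind => by
    have hle := hind.lift_cardinalMk_le_trdeg
    rw [MvPolynomial.trdeg_of_isDomain] at hle
    simp only [Cardinal.mk_fintype, Cardinal.lift_natCast, Nat.cast_le] at hle
    omega
  by_contra! hcon
  exact hdep ((injective_iff_map_eq_zero _).2 fun Q hQ => by_contra fun hQ0 => hcon Q hQ0 hQ)

theorem eval_map_eval_sumAlgEquiv (a : ι → K) (b : ρ → K) (Q : MvPolynomial (ι ⊕ ρ) K) :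
    eval a ((sumAlgEquiv K ι ρ Q).map (eval b)) = eval (Sum.elim a b) Q := by
  induction Q using MvPolynomial.induction_on with
  | C a => simp
  | add p q hp hq => simp only [map_add, hp, hq]
  | mul_X p i hp => rcases i with i | i <;> simp [hp]

theorem exists_relation_on_fibers [Fintype ι] [Fintype ρ] [Fintype τ]
    (f : ι → MvPolynomial τ K) (g : ρ → MvPolynomial τ K)
    (hcard : Fintype.card τ < Fintype.card ι + Fintype.card ρ) :
    ∃ D : MvPolynomial ρ K, D ≠ 0 ∧ ∀ c : ρ → K, eval c D ≠ 0 →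
      ∃ q : MvPolynomial ι K, q ≠ 0 ∧ ∀ z : τ → K, (∀ m, eval z (g m) = c m) →
        eval (fun i => eval z (f i)) q = 0 := by
  obtain ⟨Q, hQ0, hQ⟩ := exists_aeval_eq_zero_of_card_lt (Sum.elim f g)
    (by rwa [Fintype.card_sum])
  obtain ⟨m, hm⟩ := ne_zero_iff.1 ((map_ne_zero_iff _ (sumAlgEquiv K ι ρ).injective).2 hQ0)
  refine ⟨coeff m (sumAlgEquiv K ι ρ Q), hm, fun c hc => ⟨(sumAlgEquiv K ι ρ Q).map (eval c),
    fun h0 => hc ?_, fun z hz => ?_⟩⟩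
  · rw [← coeff_map, h0, coeff_zero]
  · have hsplit : Sum.elim (fun i => eval z (f i)) c = fun s => eval z (Sum.elim f g s) := by
      ext (i | m)
      · rfl
      · exact (hz m).symm
    have heval : eval z (aeval (Sum.elim f g) Q) =
        eval (fun s => eval z (Sum.elim f g s)) Q := by
      rw [← aeval_eq_eval, ← aeval_eq_eval, ← comp_aeval_apply]
    rw [eval_map_eval_sumAlgEquiv, hsplit, ← heval, hQ, map_zero]

end Elimination

/-! ### Forms with a prescribed restriction to a line -/

/-- The exponents of the quaternary monomials of degree `d`, which index the coefficients of the
forms of degree `d`. -/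
abbrev FormExponent (d : ℕ) : Type := (Finset.univ : Finset (Fin 4)).finsuppAntidiag d

namespace FormExponent

/-- The monomial with exponent `m` does not vanish on the line with coordinates `0` in the chart
attached to `σ`. -/
abbrev IsOn {d : ℕ} (σ : Equiv.Perm (Fin 4)) (m : FormExponent d) : Prop :=
  m.1 (σ 2) = 0 ∧ m.1 (σ 3) = 0

theorem mem_iff {d : ℕ} {m : Fin 4 →₀ ℕ} :
    m ∈ (Finset.univ : Finset (Fin 4)).finsuppAntidiag d ↔ m.degree = d := by
  simp [Finsupp.degree_eq_sum]

variable {d : ℕ} (σ : Equiv.Perm (Fin 4))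

theorem sum_perm (m : FormExponent d) :
    m.1 (σ 0) + m.1 (σ 1) + m.1 (σ 2) + m.1 (σ 3) = d := by
  rw [← Fin.sum_univ_four (fun j => m.1 (σ j)), Equiv.sum_comp σ m.1, ← Finsupp.degree_eq_sum,
    mem_iff.1 m.2]

variable {σ} in
theorem IsOn.ext {m m' : FormExponent d} (hm : IsOn σ m) (hm' : IsOn σ m')
    (h : m.1 (σ 1) = m'.1 (σ 1)) : m = m' := by
  obtain ⟨hm2, hm3⟩ := hm
  obtain ⟨hm2', hm3'⟩ := hm'
  have hsum := m.sum_perm σ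
  have hsum' := m'.sum_perm σ
  ext i
  obtain ⟨j, rfl⟩ := σ.surjective i
  fin_cases j <;> simp only [Fin.zero_eta, Fin.mk_one, Fin.reduceFinMk] <;> omega

/-- The exponents of the monomials of degree `d` that vanish on the line with coordinates `0` in
the chart attached to `σ`. -/
abbrev Off (d : ℕ) (σ : Equiv.Perm (Fin 4)) : Type :=
  {m : FormExponent d // ¬ IsOn σ m}

theorem card_off_add_le :
    Fintype.card (Off d σ) + (d + 1) ≤ Fintype.card (FormExponent d) := by
  let on (j : Fin (d + 1)) : {m : FormExponent d // IsOn σ m} :=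
    ⟨⟨Finsupp.single (σ 0) (d - j) + Finsupp.single (σ 1) j.1, mem_iff.2 (by
      rw [map_add, Finsupp.degree_single, Finsupp.degree_single]
      omega)⟩, by simp [IsOn]⟩
  have hon : Function.Injective on := fun j j' h => Fin.ext <| by
    have h1 : (on j).1.1 (σ 1) = (on j').1.1 (σ 1) := by rw [h]
    simpa [on] using h1
  have hcard := Fintype.card_le_of_injective on hon
  rw [Fintype.card_fin] at hcard
  have hsplit := Fintype.card_subtype_compl fun m : FormExponent d => IsOn σ m
  have hle := Fintype.card_subtype_le fun m : FormExponent d => IsOn σ m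
  rw [hsplit]
  omega

end FormExponent

/-- A generic form of degree `d` has the property `P`: `P` holds for the forms at whose coefficients
some nonzero polynomial `D` does not vanish. -/
def ForGenericForm (d : ℕ) (P : MvPolynomial (Fin 4) ℂ → Prop) : Prop :=
  ∃ D : MvPolynomial (FormExponent d) ℂ, D ≠ 0 ∧ ∀ F : MvPolynomial (Fin 4) ℂ,
    F.IsHomogeneous d → eval (fun m : FormExponent d => coeff m.1 F) D ≠ 0 → P F

namespace ForGenericForm

variable {d : ℕ}

theorem mono {P P' : MvPolynomial (Fin 4) ℂ → Prop} (h : ForGenericForm d P)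
    (hPP' : ∀ F, F.IsHomogeneous d → P F → P' F) : ForGenericForm d P' :=
  let ⟨D, hD0, hD⟩ := h
  ⟨D, hD0, fun F hF hFD => hPP' F hF (hD F hF hFD)⟩

theorem and {P P' : MvPolynomial (Fin 4) ℂ → Prop} (h : ForGenericForm d P)
    (h' : ForGenericForm d P') : ForGenericForm d fun F => P F ∧ P' F := by
  obtain ⟨D, hD0, hD⟩ := h
  obtain ⟨D', hD0', hD'⟩ := h'
  refine ⟨D * D', mul_ne_zero hD0 hD0', fun F hF hFD => ?_⟩
  rw [map_mul] at hFD
  exact ⟨hD F hF (left_ne_zero_of_mul hFD), hD' F hF (right_ne_zero_of_mul hFD)⟩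

theorem forall_finite {α : Type*} [Finite α] {P : α → MvPolynomial (Fin 4) ℂ → Prop}
    (h : ∀ a, ForGenericForm d (P a)) : ForGenericForm d fun F => ∀ a, P a F := by
  cases nonempty_fintype α
  choose D hD0 hD using h
  refine ⟨∏ a, D a, Finset.prod_ne_zero_iff.2 fun a _ => hD0 a, fun F hF hFD a => ?_⟩
  rw [map_prod] at hFD
  exact hD a F hF (Finset.prod_ne_zero_iff.1 hFD a (Finset.mem_univ a))

end ForGenericForm

namespace ProjLine

open FormExponent

variable {d : ℕ} {F : MvPolynomial (Fin 4) ℂ} (σ : Equiv.Perm (Fin 4))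

theorem coeff_alongLine_eq_sum (hF : F.IsHomogeneous d) (a b : Fin 4 → ℂ) (j : ℕ) :
    (alongLine F a b).coeff j =
      ∑ m : FormExponent d, coeff m.1 F * (alongLine (monomial m.1 1) a b).coeff j := by
  have hsum : F = ∑ m : FormExponent d, coeff m.1 F • monomial m.1 (1 : ℂ) := by
    conv_lhs => rw [F.as_sum]
    rw [Finset.sum_coe_sort _ fun m => coeff m F • monomial m (1 : ℂ)]
    refine (Finset.sum_subset (fun m hm => ?_) fun m _ hm => ?_).trans
      (Finset.sum_congr rfl fun m _ => by rw [smul_monomial, smul_eq_mul, mul_one])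
    · exact mem_iff.2 (by_contra fun h => mem_support_iff.1 hm (hF.coeff_eq_zero h))
    · rw [notMem_support_iff.1 hm, monomial_zero]
  conv_lhs => rw [hsum]
  simp only [alongLine, map_sum, map_smul, Polynomial.finsetSum_coeff, Polynomial.coeff_smul,
    smul_eq_mul]

theorem alongLine_monomial_of_isOn (x : Fin 4 → ℂ) {m : FormExponent d}
    (hm : IsOn σ m) :
    alongLine (monomial m.1 1) (chartFst σ x) (chartSnd σ x) = Polynomial.X ^ m.1 (σ 1) := by
  rw [alongLine, aeval_monomial, Finsupp.prod_fintype _ _ fun i => pow_zero _, ← Equiv.prod_comp σ,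
    Fin.prod_univ_four]
  simp [hm.1, hm.2]

theorem coeff_eq_coeff_alongLine_sub (hF : F.IsHomogeneous d) (x : Fin 4 → ℂ)
    {m : FormExponent d} (hm : IsOn σ m) :
    coeff m.1 F = (alongLine F (chartFst σ x) (chartSnd σ x)).coeff (m.1 (σ 1)) -
      ∑ k : Off d σ, coeff k.1.1 F *
        (alongLine (monomial k.1.1 1) (chartFst σ x) (chartSnd σ x)).coeff (m.1 (σ 1)) := by
  rw [coeff_alongLine_eq_sum hF, ← Fintype.sum_subtype_add_sum_subtype
    (fun m : FormExponent d => IsOn σ m), add_sub_cancel_right,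
    Fintype.sum_eq_single ⟨m, hm⟩ fun k hk => ?_]
  · rw [alongLine_monomial_of_isOn σ x hm, Polynomial.coeff_X_pow_self, mul_one]
  · rw [alongLine_monomial_of_isOn σ x k.2, Polynomial.coeff_X_pow, if_neg, mul_zero]
    exact fun h => hk (Subtype.ext (k.2.ext hm h.symm))

variable {τ : Type*}

/-- The coefficients of the form of degree `d` whose restriction to a line of the chart of `σ` is
`f`, as polynomials in the coordinates of the line, the coefficients of the form at the exponents
`Off d σ` and the parameters of `f`. -/
noncomputable def formCoeff (f : Polynomial (MvPolynomial τ ℂ)) (m : FormExponent d) :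
    MvPolynomial (Fin 4 ⊕ Off d σ ⊕ τ) ℂ :=
  if h : IsOn σ m then rename (.inr ∘ .inr) (f.coeff (m.1 (σ 1))) -
    ∑ k : Off d σ, X (.inr (.inl k)) *
      rename .inl ((familyLine (monomial k.1.1 1) σ 0).coeff (m.1 (σ 1)))
  else X (.inr (.inl ⟨m, h⟩))

theorem eval_formCoeff (hF : F.IsHomogeneous d) {f : Polynomial (MvPolynomial τ ℂ)}
    {x : Fin 4 → ℂ} {y : τ → ℂ}
    (h : alongLine F (chartFst σ x) (chartSnd σ x) = f.map (eval y)) (m : FormExponent d) :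
    eval (Sum.elim x (Sum.elim (fun k : Off d σ => coeff k.1.1 F) y)) (formCoeff σ f m) =
      coeff m.1 F := by
  by_cases hm : IsOn σ m
  · rw [formCoeff, dif_pos hm, coeff_eq_coeff_alongLine_sub σ hF x hm, h, Polynomial.coeff_map]
    simp only [map_sub, map_sum, map_mul, eval_X, eval_rename, Sum.elim_inr, Sum.elim_inl,
      ← Function.comp_assoc, Sum.elim_comp_inr, Sum.elim_comp_inl]
    simp only [← Polynomial.coeff_map, map_familyLine, zero_smul, add_zero]
  · rw [formCoeff, dif_neg hm, eval_X, Sum.elim_inr, Sum.elim_inl]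

theorem forGenericForm_relation_of_alongLine_eq_map {ι : Type*} [Fintype ι] [Fintype τ]
    (f : Polynomial (MvPolynomial τ ℂ)) (e : ι → Fin 4)
    (hcard : 4 + Fintype.card τ ≤ d + Fintype.card ι) :
    ForGenericForm d fun F => ∃ q : MvPolynomial ι ℂ, q ≠ 0 ∧ ∀ (x : Fin 4 → ℂ) (y : τ → ℂ),
      alongLine F (chartFst σ x) (chartSnd σ x) = f.map (eval y) → eval (x ∘ e) q = 0 := by
  obtain ⟨D, hD0, hD⟩ := exists_relation_on_fibers
    (fun i => (X (.inl (e i)) : MvPolynomial (Fin 4 ⊕ Off d σ ⊕ τ) ℂ)) (formCoeff σ f) (by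
      have := card_off_add_le (d := d) σ
      simp only [Fintype.card_sum, Fintype.card_fin]
      omega)
  refine ⟨D, hD0, fun F hF hFD => ?_⟩
  obtain ⟨q, hq0, hq⟩ := hD _ hFD
  refine ⟨q, hq0, fun x y hxy => ?_⟩
  have h := hq _ (eval_formCoeff σ hF hxy)
  simp only [eval_X, Sum.elim_inl] at h
  exact h

end ProjLine

/-! ### Relations between the coordinates of special lines -/

theorem eval_ne_zero_of_isEmpty {R ι : Type*} [CommSemiring R] [IsEmpty ι] {q : MvPolynomial ι R}
    (hq : q ≠ 0) (x : ι → R) : eval x q ≠ 0 := by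
  rw [eq_C_of_isEmpty q] at hq ⊢
  rwa [eval_C, ← (C_injective ι R).ne_iff, C_0]

namespace ProjLine

variable {d : ℕ} (σ : Equiv.Perm (Fin 4))

theorem forGenericForm_alongLine_ne_zero (hd : 4 ≤ d) :
    ForGenericForm d fun F => ∀ x : Fin 4 → ℂ, alongLine F (chartFst σ x) (chartSnd σ x) ≠ 0 := by
  refine (forGenericForm_relation_of_alongLine_eq_map σ (0 : Polynomial (MvPolynomial Empty ℂ))
    (Empty.elim : Empty → Fin 4) (by simpa using hd)).mono fun F _ ⟨q, hq0, hq⟩ x hx => ?_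
  exact eval_ne_zero_of_isEmpty hq0 _ (hq x 0 (by rw [hx, Polynomial.map_zero]))

theorem exists_alongLine_eq_C_mul_prodRoots {F : MvPolynomial (Fin 4) ℂ} (hF : F.IsHomogeneous d)
    (a b : Fin 4 → ℂ) : ∃ (μ : Fin (alongLine F a b).roots.toFinset.card → Fin (d + 1))
      (r : Fin (alongLine F a b).roots.toFinset.card → ℂ),
      alongLine F a b = Polynomial.C (alongLine F a b).leadingCoeff *
        prodRoots (fun i => (μ i : ℕ)) r := by
  have h := exists_eq_C_mul_prodRoots (alongLine F a b)
  rw [card_rootPartition] at h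
  obtain ⟨μ, r, hμ, hf⟩ := h
  have hsum : ∑ i, μ i ≤ d := by
    rw [Finset.sum, hμ, sum_rootPartition]
    exact natDegree_alongLine_le hF a b
  have hle (i) : μ i < d + 1 := Nat.lt_succ_of_le
    ((Finset.single_le_sum (fun _ _ => Nat.zero_le _) (Finset.mem_univ i)).trans hsum)
  exact ⟨fun i => ⟨μ i, hle i⟩, r, hf⟩

theorem forGenericForm_relation_of_card_roots_le {ι : Type*} [Fintype ι] (e : ι → Fin 4) :
    ForGenericForm d fun F => ∃ q : MvPolynomial ι ℂ, q ≠ 0 ∧ ∀ x : Fin 4 → ℂ,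
      (alongLine F (chartFst σ x) (chartSnd σ x)).roots.toFinset.card + 5 ≤ d + Fintype.card ι →
        eval (x ∘ e) q = 0 := by
  -- A nonzero restriction with `k` roots is given by its leading coefficient and these roots.
  let f (i : Σ k : Fin (d + Fintype.card ι - 4), Fin k → Fin (d + 1)) :
      Polynomial (MvPolynomial (Option (Fin i.1)) ℂ) :=
    Polynomial.C (X none) * prodRoots (ι := Fin i.1) (fun l => i.2 l)
      fun l => (X (some l) : MvPolynomial (Option (Fin i.1)) ℂ)
  refine (ForGenericForm.forall_finite fun i =>
    forGenericForm_relation_of_alongLine_eq_map σ (f i) e ?_).mono fun F hF h => ?_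
  · have := i.1.2
    rw [Fintype.card_option, Fintype.card_fin]
    omega
  choose q hq0 hq using h
  refine ⟨∏ i, q i, Finset.prod_ne_zero_iff.2 fun i _ => hq0 i, fun x hx => ?_⟩
  obtain ⟨μ, r, hμ⟩ := exists_alongLine_eq_C_mul_prodRoots hF (chartFst σ x) (chartSnd σ x)
  have hk := Nat.lt_sub_of_add_lt (Nat.lt_of_succ_le hx)
  rw [map_prod]
  refine Finset.prod_eq_zero (Finset.mem_univ ⟨⟨_, hk⟩, μ⟩)
    (hq _ x (fun o => o.elim (alongLine F (chartFst σ x) (chartSnd σ x)).leadingCoeff r) ?_)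
  simp only [f, Polynomial.map_mul, Polynomial.map_C, map_prodRoots, eval_X]
  exact hμ

end ProjLine

section Scaling

variable {K κ : Type*} [Field K] [Infinite K]

theorem exists_eval_ne_zero {D : MvPolynomial κ K} (hD : D ≠ 0) : ∃ c : κ → K, eval c D ≠ 0 := by
  by_contra! hcon
  exact hD (MvPolynomial.funext fun c => by rw [hcon c, map_zero])

theorem exists_homogeneousComponent_ne_zero {R : Type*} [CommSemiring R] {D : MvPolynomial κ R}
    (hD : D ≠ 0) : ∃ j, homogeneousComponent j D ≠ 0 := by
  by_contra! hcon
  rw [← sum_homogeneousComponent D, Finset.sum_eq_zero fun j _ => hcon j] at hD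
  exact hD rfl

theorem exists_smul_eval_ne_zero {D : MvPolynomial κ K} {c : κ → K} {j : ℕ}
    (h : eval c (homogeneousComponent j D) ≠ 0) : ∃ s : K, s ≠ 0 ∧ eval (s • c) D ≠ 0 := by
  let P : Polynomial K := ∑ i ∈ Finset.range (D.totalDegree + 1),
    Polynomial.monomial i (eval c (homogeneousComponent i D))
  have hP (s : K) : P.eval s = eval (s • c) D := by
    conv_rhs => rw [← sum_homogeneousComponent D]
    rw [map_sum, Polynomial.eval_finsetSum]
    refine Finset.sum_congr rfl fun i _ => ?_
    rw [eval_smul_of_isHomogeneous (homogeneousComponent_isHomogeneous i D),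
      Polynomial.eval_monomial, mul_comm]
  have hj : j ∈ Finset.range (D.totalDegree + 1) := Finset.mem_range.2 <| Nat.lt_succ_of_le <| by
    by_contra! hj
    exact h (by rw [homogeneousComponent_eq_zero _ _ hj, map_zero])
  have hP0 : P ≠ 0 := fun h0 => h <| by
    have hcoeff : P.coeff j = eval c (homogeneousComponent j D) := by
      simp only [P, Polynomial.finsetSum_coeff, Polynomial.coeff_monomial, Finset.sum_ite_eq', hj,
        if_true]
    rw [← hcoeff, h0, Polynomial.coeff_zero]
  by_contra! hcon
  refine mul_ne_zero Polynomial.X_ne_zero hP0 (Polynomial.funext fun s => ?_)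
  rw [Polynomial.eval_mul, Polynomial.eval_X, hP, Polynomial.eval_zero, mul_eq_zero]
  exact or_iff_not_imp_left.2 (hcon s)

end Scaling

theorem exists_isHomogeneous_coeff_eq {d : ℕ} (c : FormExponent d → ℂ) :
    ∃ F : MvPolynomial (Fin 4) ℂ, F.IsHomogeneous d ∧
      (fun m : FormExponent d => coeff m.1 F) = c := by
  refine ⟨∑ m, monomial m.1 (c m), IsHomogeneous.sum _ _ _ fun m _ =>
    isHomogeneous_monomial _ (FormExponent.mem_iff.1 m.2), funext fun m => ?_⟩
  simp only [coeff_sum, coeff_monomial, Subtype.coe_inj, Finset.sum_ite_eq', Finset.mem_univ,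
    if_true]

namespace Surface

variable {d : ℕ}

theorem exists_form_eq_smul {F : MvPolynomial (Fin 4) ℂ} (hF : F.IsHomogeneous d) (hF0 : F ≠ 0) :
    ∃ (X : Surface d) (a : ℂˣ), X.form = (a : ℂ) • F := by
  have hF' : (⟨F, hF⟩ : homogeneousSubmodule (Fin 4) ℂ d) ≠ 0 := fun h =>
    hF0 (congrArg Subtype.val h)
  obtain ⟨a, ha⟩ := Projectivization.exists_smul_eq_mk_rep ℂ _ hF'
  exact ⟨_, a, (congrArg Subtype.val ha).symm⟩

theorem exists_isOpen_of_forGenericForm {P : MvPolynomial (Fin 4) ℂ → Prop}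
    (hP : ForGenericForm d P) : ∃ U : Set (Surface d), IsOpen U ∧ U.Nonempty ∧
      ∀ X ∈ U, ∃ s : ℂ, s ≠ 0 ∧ P (s • X.form) := by
  obtain ⟨D, hD0, hD⟩ := hP
  obtain ⟨j, hj⟩ := exists_homogeneousComponent_ne_zero hD0
  set E := homogeneousComponent j D
  have hE : E.IsHomogeneous j := homogeneousComponent_isHomogeneous j D
  have hrename (F : MvPolynomial (Fin 4) ℂ) : eval (fun m => coeff m F) (rename Subtype.val E) =
      eval (fun m : FormExponent d => coeff m.1 F) E := eval_rename _ _ _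
  refine ⟨{X | eval (fun m => X.form.coeff m) (rename Subtype.val E) ≠ 0},
    isOpen_generateFrom_of_mem ⟨j, _, hE.rename_isHomogeneous, rfl⟩, ?_, fun X hX => ?_⟩
  · let m₀ : FormExponent d := ⟨Finsupp.single 0 d, by simp⟩
    -- The factor `X m₀` makes the form nonzero, also when `E` is constant.
    obtain ⟨c, hc⟩ := exists_eval_ne_zero (mul_ne_zero hj (X_ne_zero (R := ℂ) m₀))
    rw [map_mul, eval_X] at hc
    obtain ⟨F, hF, rfl⟩ := exists_isHomogeneous_coeff_eq c
    have hF0 : F ≠ 0 := fun h0 => right_ne_zero_of_mul hc (by simp only [h0, coeff_zero])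
    obtain ⟨Y, a, hY⟩ := exists_form_eq_smul hF hF0
    refine ⟨Y, ?_⟩
    rw [Set.mem_ofPred_eq, hrename, hY]
    exact (eval_smul_of_isHomogeneous hE _ _).trans_ne
      (mul_ne_zero (pow_ne_zero _ a.ne_zero) (left_ne_zero_of_mul hc))
  · rw [Set.mem_ofPred_eq, hrename] at hX
    obtain ⟨s, hs, hsD⟩ := exists_smul_eval_ne_zero hX
    refine ⟨s, hs, hD _ ?_ hsD⟩
    exact Submodule.smul_mem (homogeneousSubmodule (Fin 4) ℂ d) s X.isHomogeneous_form

/-- In each chart, any `p` coordinates of the lines meeting `X` in at most `d + p - 5` points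
satisfy a nontrivial relation. For `p = 0`, this says that there is no such line. -/
def HasRelations (X : Surface d) : Prop :=
  ∀ (σ : Equiv.Perm (Fin 4)) (p : ℕ) (e : Fin p ↪ Fin 4), ∃ q : MvPolynomial (Fin p) ℂ, q ≠ 0 ∧
    ∀ x : ZariskiAffine ℂ (Fin 4), (X.interPartition (ProjLine.chart σ x)).card + 5 ≤ d + p →
      eval (x.coord ∘ e) q = 0

theorem exists_isOpen_hasRelations (hd : 4 ≤ d) :
    ∃ U : Set (Surface d), IsOpen U ∧ U.Nonempty ∧
      ∀ X ∈ U, (∀ L, ¬ X.ContainsLine L) ∧ X.HasRelations := by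
  obtain ⟨U, hU, hUne, hUX⟩ := exists_isOpen_of_forGenericForm
    ((ForGenericForm.forall_finite fun σ => ProjLine.forGenericForm_alongLine_ne_zero σ hd).and
      (ForGenericForm.forall_finite fun i : Equiv.Perm (Fin 4) × Σ p : Fin 5, Fin p ↪ Fin 4 =>
        ProjLine.forGenericForm_relation_of_card_roots_le i.1 i.2.2))
  refine ⟨U, hU, hUne, fun X hX => ?_⟩
  obtain ⟨s, hs, hne, hrel⟩ := hUX X hX
  have hsmul (a b : Fin 4 → ℂ) : alongLine (s • X.form) a b = s • alongLine X.form a b :=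
    map_smul _ s X.form
  have hlines (L : ProjLine) : ¬ X.ContainsLine L := fun hL => by
    obtain ⟨σ, x, rfl⟩ := ProjLine.exists_chart L
    have hzero : alongLine X.form (ProjLine.chartFst σ x.coord) (ProjLine.chartSnd σ x.coord) = 0 :=
      Polynomial.funext fun t => by
        rw [eval_alongLine, Polynomial.eval_zero]
        exact hL _ (Submodule.mem_span_pair.2 ⟨1, t, by rw [one_smul]⟩)
    exact hne σ x.coord (by rw [hsmul, hzero, smul_zero])
  refine ⟨hlines, fun σ p e => ?_⟩
  have hp : p < 5 := by simpa [Nat.lt_succ_iff] using Fintype.card_le_of_embedding e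
  obtain ⟨q, hq0, hq⟩ := hrel ⟨σ, ⟨p, hp⟩, e⟩
  refine ⟨q, hq0, fun x hx => hq x.coord ?_⟩
  have hle := card_roots_le_card_interPartition (hlines _) (ProjLine.span_chart σ x)
    (ProjLine.linearIndependent_chart σ x.coord)
  rw [hsmul, Polynomial.roots_smul_nonzero _ hs, Fintype.card_fin]
  exact (Nat.add_le_add_right hle 5).trans hx

end Surface

/-! ### The strata of a generic surface -/

theorem ZariskiAffine.finite_of_relations {K κ : Type*} [Field K] [Finite κ]
    {T : Set (ZariskiAffine K κ)}
    (h : ∀ ι : Fin 1 ↪ κ, ∃ q : MvPolynomial (Fin 1) K, q ≠ 0 ∧ ∀ x ∈ T, eval (x.coord ∘ ι) q = 0) :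
    T.Finite := by
  choose q hq0 hq using fun i : κ =>
    h ⟨fun _ => i, Function.injective_of_subsingleton _⟩
  let Z (i : κ) : Set K := {t | eval (fun _ => t) (q i) = 0}
  have hZ (i : κ) : (Z i).Finite := by
    by_contra hinf
    refine hq0 i (funext_set (fun _ => Z i) (fun _ => hinf) fun y hy => ?_)
    have hy0 : (fun _ => y 0) = y := funext fun j => congrArg y (Subsingleton.elim 0 j)
    rw [map_zero, ← hy0]
    exact hy 0 trivial
  refine ((Set.Finite.pi' hZ).preimage fun x _ y _ hxy => ?_).subset fun x hx i => hq i x hx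
  exact ZariskiAffine.ext hxy

namespace Surface

open ProjLine

variable {d : ℕ} {X : Surface d}

theorem exists_eq_withOnes_of_not_containsLine {L : ProjLine} (hL : ¬ X.ContainsLine L) :
    ∃ s : Multiset ℕ, (∀ n ∈ s, 2 ≤ n) ∧ X.interPartition L = withOnes d s ∧
      s.sum + (X.interPartition L).card = s.card + d :=
  exists_eq_withOnes (interPartition_spec hL).1 (interPartition_spec hL).2

theorem HasRelations.le_card_interPartition (hrel : X.HasRelations) (L : ProjLine) :
    d ≤ (X.interPartition L).card + 4 := by
  obtain ⟨σ, x, rfl⟩ := exists_chart L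
  by_contra! hcon
  obtain ⟨q, hq0, hq⟩ := hrel σ 0 Function.Embedding.ofIsEmpty
  exact eval_ne_zero_of_isEmpty hq0 _ (hq x hcon)

section

variable (hX : ∀ L, ¬ X.ContainsLine L)
include hX

theorem card_interPartition_of_mem_stratum {s : Multiset ℕ} {L : ProjLine}
    (hL : L ∈ X.stratum s) : (X.interPartition L).card + s.sum = s.card + d := by
  have hpart : X.interPartition L = withOnes d s := hL
  have hsum := (interPartition_spec (hX L)).2
  rw [hpart] at hsum ⊢
  exact card_withOnes (sum_le_of_sum_withOnes_eq hsum)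

variable (hrel : X.HasRelations)
include hrel

theorem nonempty_stratum_zero : (X.stratum 0).Nonempty := by
  obtain ⟨q, hq0, hq⟩ := hrel 1 4 (.refl _)
  obtain ⟨c, hc⟩ := exists_eval_ne_zero hq0
  obtain ⟨hpos, hsum⟩ := interPartition_spec (hX (chart 1 ⟨c⟩))
  refine ⟨chart 1 ⟨c⟩, eq_withOnes_zero_of_le_card hpos hsum ?_⟩
  by_contra! hcard
  exact hc (hq ⟨c⟩ (by omega))

theorem exists_relation_of_mem_stratum {s : Multiset ℕ} {p : ℕ}
    (hs : s.card + 5 ≤ s.sum + p) (σ : Equiv.Perm (Fin 4)) (e : Fin p ↪ Fin 4) :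
    ∃ q : MvPolynomial (Fin p) ℂ, q ≠ 0 ∧
      ∀ x ∈ chart σ ⁻¹' X.stratum s, eval (x.coord ∘ e) q = 0 := by
  obtain ⟨q, hq0, hq⟩ := hrel σ p e
  refine ⟨q, hq0, fun x hx => hq x ?_⟩
  have := card_interPartition_of_mem_stratum hX hx
  omega

theorem topologicalKrullDim_stratum_le {s : Multiset ℕ} {n : ℕ}
    (hs : s.card + 4 ≤ s.sum + n) : topologicalKrullDim (X.stratum s) ≤ n :=
  topologicalKrullDim_le_of_chart fun σ => ZariskiAffine.topologicalKrullDim_le_of_relations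
    (exists_relation_of_mem_stratum hX hrel (by omega) σ)

theorem finite_stratum {s : Multiset ℕ} (hs : s.card + 4 ≤ s.sum) : (X.stratum s).Finite := by
  have hchart (σ : Equiv.Perm (Fin 4)) : (chart σ ⁻¹' X.stratum s).Finite :=
    ZariskiAffine.finite_of_relations (exists_relation_of_mem_stratum hX hrel (by omega) σ)
  refine (Set.finite_iUnion fun σ => (hchart σ).image (chart σ)).subset fun L hL => ?_
  obtain ⟨σ, x, rfl⟩ := exists_chart L
  exact Set.mem_iUnion.2 ⟨σ, x, hL, rfl⟩

theorem isLocallyClosedOfDim_stratum {s : Multiset ℕ} {n : ℕ}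
    (hs : s.card + 4 = s.sum + n) : IsLocallyClosedOfDim (X.stratum s) n := by
  refine ⟨isLocallyClosed_stratum hX s, fun ⟨L, hL⟩ =>
    le_antisymm (topologicalKrullDim_stratum_le hX hrel hs.le) ?_⟩
  have hle := le_topologicalKrullDim_stratum_inter hX hL isOpen_univ (Set.mem_univ L) (n := n)
    (by omega)
  rwa [Set.inter_univ] at hle

theorem isLocallyClosedHypersurface_stratum {s : Multiset ℕ} (hs : s.card + 1 = s.sum) :
    IsLocallyClosedHypersurface (X.stratum s) := by
  refine ⟨isLocallyClosed_stratum hX s, fun Z hZ => le_antisymm ?_ ?_⟩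
  · exact (topologicalKrullDim_subspace_le _ Z).trans
      (topologicalKrullDim_stratum_le hX hrel (n := 3) (by omega))
  · obtain ⟨V, hV, ⟨L, hLV⟩, hVZ⟩ :=
      NoetherianSpace.exists_isOpen_nonempty_subset_irreducibleComponent Z hZ
    obtain ⟨O, hO, rfl⟩ := isOpen_induced_iff.1 hV
    refine (le_topologicalKrullDim_stratum_inter hX L.2 hO hLV (n := 3) (by omega)).trans ?_
    let f (M : (X.stratum s ∩ O : Set ProjLine)) : Z := ⟨⟨M.1, M.2.1⟩, hVZ M.2.2⟩
    have hf : IsInducing f := by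
      rw [← (IsInducing.subtypeVal.comp IsInducing.subtypeVal :
        IsInducing ((Subtype.val : X.stratum s → ProjLine) ∘ (Subtype.val : Z → _))).of_comp_iff]
      exact IsInducing.subtypeVal
    exact hf.topologicalKrullDim_le

end

end Surface

theorem theorem3p3 (d : ℕ) (hd : 4 ≤ d) :
    ∃ U : Set (Surface d), IsOpen U ∧ U.Nonempty ∧ ∀ X ∈ U,
      (∀ L : ProjLine, ¬ X.ContainsLine L) ∧
      (∀ L : ProjLine, ∃ s ∈ ({0, {2}, {2, 2}, {3}, {2, 2, 2}, {3, 2}, {4},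
          {2, 2, 2, 2}, {3, 2, 2}, {3, 3}, {4, 2}, {5}} : Set (Multiset ℕ)),
        X.interPartition L = withOnes d s) ∧
      (IsOpen (X.stratum 0) ∧ (X.stratum 0).Nonempty) ∧
      IsLocallyClosedHypersurface (X.stratum {2}) ∧
      IsLocallyClosedOfDim (X.stratum {2, 2}) 2 ∧
      IsLocallyClosedOfDim (X.stratum {3}) 2 ∧
      IsLocallyClosedOfDim (X.stratum {2, 2, 2}) 1 ∧
      IsLocallyClosedOfDim (X.stratum {3, 2}) 1 ∧
      IsLocallyClosedOfDim (X.stratum {4}) 1 ∧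
      (X.stratum {2, 2, 2, 2}).Finite ∧
      (X.stratum {3, 2, 2}).Finite ∧
      (X.stratum {3, 3}).Finite ∧
      (X.stratum {4, 2}).Finite ∧
      (X.stratum {5}).Finite := by
  obtain ⟨U, hU, hUne, hUX⟩ := Surface.exists_isOpen_hasRelations hd
  refine ⟨U, hU, hUne, fun X hXU => ?_⟩
  obtain ⟨hX, hrel⟩ := hUX X hXU
  have hdim (s : Multiset ℕ) (n : ℕ) (hs : s.card + 4 = s.sum + n) :
      IsLocallyClosedOfDim (X.stratum s) n := Surface.isLocallyClosedOfDim_stratum hX hrel hs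
  have hfin (s : Multiset ℕ) (hs : s.card + 4 ≤ s.sum) : (X.stratum s).Finite :=
    Surface.finite_stratum hX hrel hs
  refine ⟨hX, fun L => ?_, ⟨Surface.isOpen_stratum_zero hX,
    Surface.nonempty_stratum_zero hX hrel⟩,
    Surface.isLocallyClosedHypersurface_stratum hX hrel rfl, hdim _ _ rfl, hdim _ _ rfl,
    hdim _ _ rfl, hdim _ _ rfl, hdim _ _ rfl, hfin _ (by decide), hfin _ (by decide),
    hfin _ (by decide), hfin _ (by decide), hfin _ (by decide)⟩
  obtain ⟨s, hs, hpart, hcard⟩ := Surface.exists_eq_withOnes_of_not_containsLine (hX L)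
  have hle := hrel.le_card_interPartition L
  exact ⟨s, mem_of_sum_le_card_add_four hs (by omega), hpart⟩
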